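/- Let $k$ be a commutative domain, let $n\ge 0$, and let $p_{ij}\in k^\times$ $(1\le i,j\le n)$ satisfy $p_{ii}=1$ and $p_{ji}=p_{ij}^{-1}$, with every $p_{ij}$ a root of unity. Let $A=k_{p_{ij}}[x_1,\dots,x_n]$ be the $k$-algebra generated by $x_1,\dots,x_n$ subject to $x_jx_i=p_{ij}x_ix_j$ for $i<j$ (a PI skew polynomial ring). Let $C(A)$ be its centre, $F$ the field of fractions of $C(A)$, $w=\mathrm{rk}(A/C(A))=\dim_F(A\otimes_{C(A)}F)$, and let $\mathrm{tr}:A\to F$ be the regular trace (the trace of left multiplication on $A\otimes_{C(A)}F$ over $F$). An element $x\in A$ is normal if $xA=Ax$; a normal $x$ divides $y$ (written $x\mid y$) if $y\in Ax$. For $v\ge 1$, a $v$-discriminant $d_v(A/C(A))$ is a greatest common divisor in $A$ of the elements $\det(\mathrm{tr}(z_iz'_j))_{v\times v}$, over all $z_1,\dots,z_v,z'_1,\dots,z'_v\in A$, that is, a normal common divisor of them which every normal common divisor of them divides; this presupposes that $A\otimes_{C(A)}F$ is finite-dimensional over $F$ and that $\mathrm{tr}(A)\subseteq C(A)$, which is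 part of the assertion. For $1\le s\le n$ put $$T_s=\Big\{(d_j)_{j\ne s}\in\mathbb N^{n-1}\ \Big|\ \prod_{j\neq s}p_{ij}^{d_j}=p_{is}\ \text{ for all } i\ne s\Big\}.$$ A nonzero $f\in A$ is called dominating if for every $\mathbb N$-filtered PI $k$-algebra $T$ whose associated graded ring $\mathrm{gr}\,T$ is a domain with degree-zero part $k$, and all $y_1,\dots,y_n\in T$ whose images in $T/F_0T$ are $k$-linearly independent, $f$ has a lift $f(X_1,\dots,X_n)$ to the free algebra $k\langle X_1,\dots,X_n\rangle$ such that either $f(y_1,\dots,y_n)=0$, or $\deg f(y_1,\dots,y_n)\ge\deg f$, with strict inequality if $\deg y_i>1$ for some $i$. Here $\deg f$ is the degree with respect to the filtration $F_mA=(k+kx_1+\dots+kx_n)^m$. Then: (1) For every $v\ge1$ the $v$-discriminant $d_v(A/C(A))$ exists. For $v\le w$ it is a monomial $c\,x_1^{a_1}\cdots x_n^{a_n}$ with $0\ne c\in k$ and $a_i\in\mathbb N$, and for $v>w$ it is $0$. In particular $d_w(A/C(A))\ne0$. (2) For every $1\le s\le n$, $x_s\mid d_w(A/C(A))$ if and only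 if $T_s=\emptyset$. (3) $d_w(A/C(A))$ is dominating if and only if $T_s=\emptyset$ for all $s=1,\dots,n$. -/

import Mathlib

open scoped TensorProduct

/-! ## Skew polynomial rings -/

/-- The defining relations `x_j x_i = p_{ij} x_i x_j` for `i < j`. -/
inductive SkewRel {k : Type*} [CommRing k] {n : ℕ} (p : Fin n → Fin n → kˣ) :
    FreeAlgebra k (Fin n) → FreeAlgebra k (Fin n) → Prop
  | comm (i j : Fin n) (hij : i < j) :
      SkewRel p (FreeAlgebra.ι k j * FreeAlgebra.ι k i)
        ((p i j : k) • (FreeAlgebra.ι k i * FreeAlgebra.ι k j))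

/-- The skew polynomial ring `k_{p_{ij}}[x_1, …, x_n]`: the `k`-algebra generated by
`x_1, …, x_n` subject to `x_j x_i = p_{ij} x_i x_j` for `i < j`. -/
abbrev SkewPoly {k : Type*} [CommRing k] {n : ℕ} (p : Fin n → Fin n → kˣ) : Type _ :=
  RingQuot (SkewRel p)

/-- The generator `x_i`. -/
noncomputable def SkewPoly.X {k : Type*} [CommRing k] {n : ℕ} (p : Fin n → Fin n → kˣ)
    (i : Fin n) : SkewPoly p :=
  RingQuot.mkAlgHom k (SkewRel p) (FreeAlgebra.ι k i)

/-- `d` is a monomial `c x_1^{a_1} ⋯ x_n^{a_n}` with `0 ≠ c ∈ k`. -/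
def SkewPoly.IsMonomial {k : Type*} [CommRing k] {n : ℕ} (p : Fin n → Fin n → kˣ)
    (d : SkewPoly p) : Prop :=
  ∃ (c : k) (a : Fin n → ℕ), c ≠ 0 ∧
    d = c • (List.ofFn fun i => SkewPoly.X p i ^ a i).prod

/-- The set `T_s` of all `(d_j)_{j ≠ s}` in `ℕ^{n-1}` such that
`∏_{j ≠ s} p_{ij}^{d_j} = p_{is}` for all `i ≠ s`. -/
def SkewPoly.T {k : Type*} [CommRing k] {n : ℕ} (p : Fin n → Fin n → kˣ) (s : Fin n) :
    Set ({j : Fin n // j ≠ s} → ℕ) :=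
  {d | ∀ i : Fin n, i ≠ s → ∏ j : {j : Fin n // j ≠ s}, p i j ^ d j = p i s}

/-! ## Discriminants over the centre -/

section Discriminant

variable (A : Type*) [Ring A]

/-- The total ring of fractions `F` of the centre `C(A)` (a field if `A` is a domain). -/
abbrev CenterFrac : Type _ := FractionRing (Subring.center A)

/-- `A_F = A ⊗_{C(A)} F`. -/
abbrev CenterLoc : Type _ := CenterFrac A ⊗[Subring.center A] A

/-- The rank `rk(A/C(A))`, i.e. the rank of `A_F` over `F`. -/
noncomputable def centerRank : ℕ := Module.finrank (CenterFrac A) (CenterLoc A)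

variable {A}

/-- The regular trace `A → F`: the trace of left multiplication by `a` on `A_F` over `F`. -/
noncomputable def regTrace (a : A) : CenterFrac A :=
  LinearMap.trace (CenterFrac A) (CenterLoc A)
    (LinearMap.mulLeft (CenterFrac A) (1 ⊗ₜ[Subring.center A] a : CenterLoc A))

/-- The discriminant `d_v(Z, Z' : tr) = det (tr(z_i z'_j))` of a pair. -/
noncomputable def pairDisc {v : ℕ} (z z' : Fin v → A) : CenterFrac A :=
  (Matrix.of fun i j => regTrace (z i * z' j)).det

/-- `x` is a normal element: `xA = Ax`. -/
def IsNormalElt (x : A) : Prop :=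
  (∀ b : A, ∃ c : A, x * b = c * x) ∧ ∀ b : A, ∃ c : A, b * x = x * c

/-- `x` divides `y`: `y = w x` for some `w ∈ A` (used for normal `x`). -/
def NDvd (x y : A) : Prop := ∃ w : A, y = w * x

/-- `x` is a normal common divisor of `D` which is divisible by every normal common divisor
of `D`. -/
structure IsNormalGCD (D : Set A) (x : A) : Prop where
  normal : IsNormalElt x
  dvd : ∀ y ∈ D, NDvd x y
  greatest : ∀ y : A, IsNormalElt y → (∀ r ∈ D, NDvd y r) → NDvd y x

/-- `d` is a `v`-discriminant `d_v(A/C(A))`. The first three fields say that this notion makes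
sense: `A_F` is finitely generated free over `F` and the regular trace takes its values
in `C(A)`. The last one says that `d` is a gcd in `A` of all the elements
`d_v(Z, Z' : tr)` of `C(A)`. -/
structure IsVDiscriminant (v : ℕ) (d : A) : Prop where
  finite : Module.Finite (CenterFrac A) (CenterLoc A)
  free : Module.Free (CenterFrac A) (CenterLoc A)
  trace_mem : ∀ a : A, ∃ c : Subring.center A, algebraMap _ (CenterFrac A) c = regTrace a
  isGCD : IsNormalGCD {r : A | ∃ (z z' : Fin v → A) (c : Subring.center A),
    (c : A) = r ∧ algebraMap _ (CenterFrac A) c = pairDisc z z'} d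

end Discriminant

/-! ## Filtered algebras, PI rings and dominating elements -/

/-- An exhaustive `ℕ`-filtration of the `k`-algebra `T`. -/
structure AlgFiltration (k T : Type*) [CommRing k] [Ring T] [Algebra k T] where
  F : ℕ → Submodule k T
  mono : Monotone F
  one_mem : (1 : T) ∈ F 0
  mul_mem : ∀ {i j : ℕ} {a b : T}, a ∈ F i → b ∈ F j → a * b ∈ F (i + j)
  exhaustive : ∀ a : T, ∃ i, a ∈ F i

namespace AlgFiltration

variable {k T : Type*} [CommRing k] [Ring T] [Algebra k T] (𝓕 : AlgFiltration k T)

/-- `F_{i-1}`, with `F_{-1} = 0`. -/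
def Fpred : ℕ → Submodule k T
  | 0 => ⊥
  | i + 1 => 𝓕.F i

theorem mul_Fpred {i j : ℕ} {a b : T} (ha : a ∈ 𝓕.F i) (hb : b ∈ 𝓕.Fpred j) :
    a * b ∈ 𝓕.Fpred (i + j) := by
  cases j with
  | zero =>
    have : b = 0 := hb
    simp [this]
  | succ j => exact 𝓕.mul_mem ha hb

theorem Fpred_mul {i j : ℕ} {a b : T} (ha : a ∈ 𝓕.Fpred i) (hb : b ∈ 𝓕.F j) :
    a * b ∈ 𝓕.Fpred (i + j) := by
  cases i with
  | zero =>
    have : a = 0 := ha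
    simp [this]
  | succ i =>
    rw [Nat.add_right_comm]
    exact 𝓕.mul_mem ha hb

/-- The Rees ring `⨁_i F_i t^i`, as a subring of `T[t]`. -/
def rees : Subring (Polynomial T) where
  carrier := {f | ∀ i, f.coeff i ∈ 𝓕.F i}
  zero_mem' := fun i => by simp
  one_mem' := fun i => by
    rw [Polynomial.coeff_one]
    split_ifs with h
    · exact 𝓕.mono (Nat.zero_le i) 𝓕.one_mem
    · exact Submodule.zero_mem _
  add_mem' := fun hf hg i => by
    rw [Polynomial.coeff_add]
    exact Submodule.add_mem _ (hf i) (hg i)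
  neg_mem' := fun hf i => by
    rw [Polynomial.coeff_neg]
    exact Submodule.neg_mem _ (hf i)
  mul_mem' := fun hf hg i => by
    rw [Polynomial.coeff_mul]
    refine Submodule.sum_mem _ fun x hx => ?_
    rw [← Finset.HasAntidiagonal.mem_antidiagonal.mp hx]
    exact 𝓕.mul_mem (hf _) (hg _)

/-- The two-sided ideal `⨁_i F_{i-1} t^i` of the Rees ring. -/
noncomputable def reesIdeal : TwoSidedIdeal 𝓕.rees :=
  TwoSidedIdeal.mk' {f | ∀ i, (f : Polynomial T).coeff i ∈ 𝓕.Fpred i}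
    (fun i => by simp)
    (fun {f g} hf hg i => by
      have := Submodule.add_mem _ (hf i) (hg i)
      simpa using this)
    (fun {f} hf i => by
      have := Submodule.neg_mem _ (hf i)
      simpa using this)
    (fun {f g} hg i => by
      rw [Subring.coe_mul, Polynomial.coeff_mul]
      refine Submodule.sum_mem _ fun x hx => ?_
      rw [← Finset.HasAntidiagonal.mem_antidiagonal.mp hx]
      exact 𝓕.mul_Fpred (f.2 _) (hg _))
    (fun {f g} hf i => by
      rw [Subring.coe_mul, Polynomial.coeff_mul]
      refine Submodule.sum_mem _ fun x hx => ?_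
      rw [← Finset.HasAntidiagonal.mem_antidiagonal.mp hx]
      exact 𝓕.Fpred_mul (hf _) (g.2 _))

theorem mem_reesIdeal (f : 𝓕.rees) :
    f ∈ 𝓕.reesIdeal ↔ ∀ i, (f : Polynomial T).coeff i ∈ 𝓕.Fpred i :=
  TwoSidedIdeal.mem_mk' _ _ _ _ _ _ _

/-- The associated graded ring `gr T = ⨁_i F_i / F_{i-1}`, realised as the quotient of the
Rees ring `⨁_i F_i t^i` by the ideal `⨁_i F_{i-1} t^i`. -/
abbrev gr : Type _ := 𝓕.reesIdeal.ringCon.Quotient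

/-- `gr T` is connected graded: its degree zero part `F_0` is `k`. -/
def GrConnected : Prop :=
  Function.Injective (algebraMap k T) ∧ 𝓕.F 0 = LinearMap.range (Algebra.linearMap k T)

/-- The degree of a (nonzero) element: the least `i` with `a ∈ F_i`. -/
noncomputable def deg (a : T) : ℕ := sInf {i | a ∈ 𝓕.F i}

end AlgFiltration

/-- `T` is a PI ring: it satisfies an identity `f = 0` where `f` is a noncommutative polynomial
with integer coefficients which is monic, i.e. one of its monomials of highest degree
has coefficient `1`. -/
def IsPIRing (T : Type*) [Ring T] : Prop :=
  ∃ f : MonoidAlgebra ℤ (FreeMonoid ℕ),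
    (∃ m, f.coeff m = 1 ∧ ∀ m' : FreeMonoid ℕ, f.coeff m' ≠ 0 → m'.length ≤ m.length) ∧
    ∀ y : ℕ → T, MonoidAlgebra.lift ℤ T (FreeMonoid ℕ) (FreeMonoid.lift y) f = 0

/-- The degree of a (nonzero) element of `A` with respect to the standard filtration
`F_m A = (k + Y)^m`, where `Y` is the span of the `x_i`. -/
noncomputable def stdDeg {k A : Type*} [CommRing k] [Ring A] [Algebra k A] {n : ℕ}
    (x : Fin n → A) (f : A) : ℕ :=
  sInf {m | f ∈ ((1 : Submodule k A) ⊔ Submodule.span k (Set.range x)) ^ m}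

universe u

/-- `f` is dominating with respect to the generators `x_1, …, x_n` of `A`. -/
def IsDominating (k : Type u) {A : Type u} [CommRing k] [Ring A] [Algebra k A] {n : ℕ}
    (x : Fin n → A) (f : A) : Prop :=
  f ≠ 0 ∧
  ∀ (T : Type u) [Ring T] [Algebra k T] (𝓕 : AlgFiltration k T),
    IsPIRing T → 𝓕.GrConnected → IsDomain 𝓕.gr →
    ∀ y : Fin n → T, LinearIndependent k (fun i => (𝓕.F 0).mkQ (y i)) →
      ∃ φ : FreeAlgebra k (Fin n), FreeAlgebra.lift k x φ = f ∧
        (FreeAlgebra.lift k y φ = 0 ∨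
          (stdDeg (k := k) x f ≤ 𝓕.deg (FreeAlgebra.lift k y φ) ∧
            ((∃ i, 1 < 𝓕.deg (y i)) →
              stdDeg (k := k) x f < 𝓕.deg (FreeAlgebra.lift k y φ))))

/-! Up to units of k, ordered monomials multiply by adding exponents, so everything can be read off
exponent vectors. Attach to x^a the tuple `commFactor p a` of scalars by which it commutes with the
variables. As the p_ij are roots of unity, these tuples form a finite group G; they grade A by G,
with the centre as trivial component. Monomials of equal class are proportional over F, one monomial
per class gives an F-basis of A_F (`exists_basis_centerLoc`), and w = |G|. Left multiplication by
x^a shifts classes, so its trace is w x^a if the class is trivial and 0 otherwise. Moreover w ≠ 0 in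
k, because a domain of characteristic q > 0 has no unit of order q
(`card_range_commFactor_ne_zero`).

Pair discriminants are multilinear over the centre, so monomial tuples suffice. Their discriminant
is zero or, after a permutation, that of a diagonal matrix: w^v times a unit times x^e, where e = ∑
(a_i + b_i), the a_i lie in distinct classes and b_i lies in the class inverse to that of a_i
(`pairDisc_basis_eq_zero_or`). Divisors of nonzero monomials are monomials
(`factors_of_mul_eq_smul_basis`), so the gcd is w^v x^m with m the componentwise minimum of these e.
For v > w linear dependence kills every discriminant.

When v = w the a_i exhaust G, so m_s = 0 exactly when every class contains a monomial without x_s.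
It is enough that the class of x_s does, which says that T_s is nonempty
(`minExponent_eq_zero_iff`). Finally, degrees add when gr T is a domain, so a monomial containing
every variable is dominating; if x_s is missing, A itself with x_s given weight 2 is a
counterexample. -/

/-! ### Exponent vectors and commutation factors -/

section Exponents

variable {n : ℕ}

theorem exponent_induction {P : (Fin n → ℕ) → Prop} (zero : P 0)
    (add_single : ∀ a i, P a → P (a + Pi.single i 1)) (a : Fin n → ℕ) : P a := by
  induction h : ∑ i, a i using Nat.strong_induction_on generalizing a with
  | _ m ih =>
    by_cases ha : a = 0
    · exact ha ▸ zero
    · obtain ⟨i, hi⟩ := Function.ne_iff.mp ha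
      have hle : Pi.single i 1 ≤ a := by
        intro j
        by_cases hj : j = i
        · subst hj; simpa [Nat.one_le_iff_ne_zero] using hi
        · simp [Pi.single_eq_of_ne hj]
      have hsum : ∑ j, a j = ∑ j, (a - Pi.single i 1 : Fin n → ℕ) j + 1 := by
        conv_lhs => rw [← tsub_add_cancel_of_le hle]
        simp only [Pi.add_apply, Finset.sum_add_distrib, Finset.sum_pi_single', Finset.mem_univ,
          if_true]
      rw [← tsub_add_cancel_of_le hle]
      exact add_single _ _ (ih _ (by omega) _ rfl)

/-- The tuple of commutation factors `∏_j p_{ij}^{a_j}` of the monomial `x^a` with the `x_i`. -/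
def commFactor {k : Type*} [CommRing k] (p : Fin n → Fin n → kˣ) (a : Fin n → ℕ) :
    Fin n → kˣ :=
  fun i => ∏ j, p i j ^ a j

variable {k : Type*} [CommRing k] (p : Fin n → Fin n → kˣ)

theorem commFactor_zero : commFactor p 0 = 1 := by
  funext i; simp [commFactor]

theorem commFactor_add (a b : Fin n → ℕ) :
    commFactor p (a + b) = commFactor p a * commFactor p b := by
  funext i; simp [commFactor, pow_add, Finset.prod_mul_distrib]

theorem commFactor_nsmul (m : ℕ) (a : Fin n → ℕ) :
    commFactor p (m • a) = commFactor p a ^ m := by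
  induction m with
  | zero => simp [commFactor_zero]
  | succ m ih => rw [succ_nsmul, commFactor_add, ih, pow_succ]

theorem commFactor_single (s i : Fin n) : commFactor p (Pi.single s 1) i = p i s := by
  rw [commFactor, Finset.prod_eq_single s]
  · simp
  · intro j _ hj; simp [Pi.single_eq_of_ne hj]
  · simp

end Exponents

/-- A `k`-basis of `A` consisting of monomials `x^a` that multiply, up to units of `k`, by adding
exponents and commute with the variables as in the skew polynomial ring `k_p[x_1, …, x_n]`. -/
structure MonomialBasis {k : Type*} [CommRing k] {n : ℕ} (p : Fin n → Fin n → kˣ)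
    (A : Type*) [Ring A] [Algebra k A] where
  basis : Module.Basis (Fin n → ℕ) k A
  basis_zero : basis 0 = 1
  cocycle : (Fin n → ℕ) → (Fin n → ℕ) → kˣ
  basis_mul : ∀ a b, basis a * basis b = (cocycle a b : k) • basis (a + b)
  basis_comm : ∀ i b, basis (Pi.single i 1) * basis b =
    (((commFactor p b i)⁻¹ : kˣ) : k) • (basis b * basis (Pi.single i 1))

/-! ### Ordered monomials as a basis of the skew polynomial ring -/

namespace SkewPoly

variable {k : Type*} [CommRing k] {n : ℕ} (p : Fin n → Fin n → kˣ)

/-- The factor in `x_i x^a = c x^{a + e_i}`. -/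
def leftFactor (i : Fin n) (a : Fin n → ℕ) : kˣ := ∏ j, if j < i then p j i ^ a j else 1

theorem leftFactor_zero (i : Fin n) : leftFactor p i 0 = 1 := by
  simp [leftFactor]

theorem leftFactor_add_single_of_lt {i j : Fin n} (h : j < i) (a : Fin n → ℕ) :
    leftFactor p i (a + Pi.single j 1) = leftFactor p i a * p j i := by
  have : p j i = ∏ l, if l = j then p j i else 1 := by simp
  conv_rhs => rw [this]
  rw [leftFactor, leftFactor, ← Finset.prod_mul_distrib]
  refine Finset.prod_congr rfl fun l _ => ?_
  by_cases hl : l = j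
  · subst hl; simp [h, pow_succ]
  · simp [hl]

theorem leftFactor_add_single_of_not_lt {i j : Fin n} (h : ¬ j < i) (a : Fin n → ℕ) :
    leftFactor p i (a + Pi.single j 1) = leftFactor p i a := by
  refine Finset.prod_congr rfl fun l _ => ?_
  by_cases hl : l = j
  · subst hl; simp [h]
  · simp [Pi.single_eq_of_ne hl]

/-- The ordered monomial `x_1^{a_1} ⋯ x_n^{a_n}`. -/
noncomputable def mon (a : Fin n → ℕ) : SkewPoly p := (List.ofFn fun i => X p i ^ a i).prod

theorem mon_zero : mon p 0 = 1 := by simp [mon, List.ofFn_const]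

theorem X_mul_X_of_lt {i j : Fin n} (h : i < j) :
    X p j * X p i = (p i j : k) • (X p i * X p j) := by
  have := RingQuot.mkAlgHom_rel k (SkewRel.comm (p := p) i j h)
  simpa [X] using this

section Skew

variable {p}

theorem X_mul_X (hdiag : ∀ i, p i i = 1) (hskew : ∀ i j, p j i = (p i j)⁻¹) (i j : Fin n) :
    X p i * X p j = (p j i : k) • (X p j * X p i) := by
  rcases lt_trichotomy i j with h | h | h
  · rw [X_mul_X_of_lt p h, smul_smul, hskew i j, Units.inv_mul, one_smul]
  · subst h; simp [hdiag]
  · exact X_mul_X_of_lt p h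

theorem X_mul_X_pow (hdiag : ∀ i, p i i = 1) (hskew : ∀ i j, p j i = (p i j)⁻¹) (i j : Fin n)
    (m : ℕ) : X p i * X p j ^ m = ((p j i ^ m : kˣ) : k) • (X p j ^ m * X p i) := by
  induction m with
  | zero => simp
  | succ m ih =>
    rw [pow_succ, ← mul_assoc, ih, smul_mul_assoc, mul_assoc, X_mul_X hdiag hskew i j,
      mul_smul_comm, smul_smul, pow_succ, Units.val_mul, mul_assoc]

theorem X_mul_list_prod (hdiag : ∀ i, p i i = 1) (hskew : ∀ i j, p j i = (p i j)⁻¹) (i : Fin n)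
    (a : Fin n → ℕ) (l : List (Fin n)) :
    X p i * (l.map fun j => X p j ^ a j).prod =
      (((l.map fun j => p j i ^ a j).prod : kˣ) : k) •
        ((l.map fun j => X p j ^ a j).prod * X p i) := by
  induction l with
  | nil => simp
  | cons j l ih =>
    rw [List.map_cons, List.prod_cons, ← mul_assoc, X_mul_X_pow hdiag hskew, smul_mul_assoc,
      mul_assoc, ih, mul_smul_comm, smul_smul, List.map_cons, List.prod_cons, Units.val_mul,
      mul_assoc]

theorem X_mul_mon_comm (hdiag : ∀ i, p i i = 1) (hskew : ∀ i j, p j i = (p i j)⁻¹) (i : Fin n)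
    (a : Fin n → ℕ) :
    X p i * mon p a = (((commFactor p a i)⁻¹ : kˣ) : k) • (mon p a * X p i) := by
  have h := X_mul_list_prod hdiag hskew i a (List.finRange n)
  rw [← List.ofFn_eq_map, ← List.ofFn_eq_map, List.prod_ofFn] at h
  rw [mon, h, commFactor, ← Finset.prod_inv_distrib]
  simp only [hskew i, inv_pow]

/-- In a sorted product x_i has to pass only the letters before it, each at the cost of a power of
p_{ji}; it then merges with its own power. -/
theorem X_mul_sorted_prod (hdiag : ∀ i, p i i = 1) (hskew : ∀ i j, p j i = (p i j)⁻¹)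
    (i : Fin n) (a : Fin n → ℕ) (l : List (Fin n)) (hl : l.Pairwise (· < ·)) (hi : i ∈ l) :
    X p i * (l.map fun j => X p j ^ a j).prod =
      (((l.map fun j => if j < i then p j i ^ a j else 1).prod : kˣ) : k) •
        (l.map fun j => X p j ^ (a + Pi.single i 1 : Fin n → ℕ) j).prod := by
  induction l with
  | nil => simp at hi
  | cons j l ih =>
    rw [List.pairwise_cons] at hl
    simp only [List.map_cons, List.prod_cons]
    by_cases hij : i = j
    · subst hij
      have h1 : (l.map fun j => if j < i then p j i ^ a j else 1) = l.map fun _ => 1 :=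
        List.map_congr_left fun j hj => if_neg (hl.1 j hj).not_gt
      have h2 : (l.map fun j => X p j ^ (a + Pi.single i 1 : Fin n → ℕ) j) =
          l.map fun j => X p j ^ a j :=
        List.map_congr_left fun j hj => by
          rw [Pi.add_apply, Pi.single_eq_of_ne (hl.1 j hj).ne', add_zero]
      rw [h1, h2]
      simp [pow_succ', mul_assoc]
    · have hil : i ∈ l := (List.mem_cons.mp hi).resolve_left hij
      rw [← mul_assoc, X_mul_X_pow hdiag hskew, smul_mul_assoc, mul_assoc, ih hl.2 hil,
        mul_smul_comm, smul_smul, if_pos (hl.1 i hil), Units.val_mul, Pi.add_apply,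
        Pi.single_eq_of_ne (Ne.symm hij), add_zero]

theorem X_mul_mon (hdiag : ∀ i, p i i = 1) (hskew : ∀ i j, p j i = (p i j)⁻¹) (i : Fin n)
    (a : Fin n → ℕ) :
    X p i * mon p a = (leftFactor p i a : k) • mon p (a + Pi.single i 1) := by
  have h := X_mul_sorted_prod hdiag hskew i a (List.finRange n) (List.pairwise_lt_finRange n)
    (List.mem_finRange i)
  rw [← List.ofFn_eq_map, ← List.ofFn_eq_map, ← List.ofFn_eq_map, List.prod_ofFn] at h
  exact h

theorem mon_add_single (hdiag : ∀ i, p i i = 1) (hskew : ∀ i j, p j i = (p i j)⁻¹) (i : Fin n)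
    (a : Fin n → ℕ) :
    mon p (a + Pi.single i 1) = (((leftFactor p i a)⁻¹ : kˣ) : k) • (X p i * mon p a) := by
  rw [X_mul_mon hdiag hskew, smul_smul, Units.inv_mul, one_smul]

theorem mon_single (hdiag : ∀ i, p i i = 1) (hskew : ∀ i j, p j i = (p i j)⁻¹) (i : Fin n) :
    mon p (Pi.single i 1) = X p i := by
  have := X_mul_mon hdiag hskew i 0
  rw [mon_zero, mul_one, leftFactor_zero, zero_add, Units.val_one, one_smul] at this
  exact this.symm

theorem exists_mon_mul_mon (hdiag : ∀ i, p i i = 1) (hskew : ∀ i j, p j i = (p i j)⁻¹)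
    (a b : Fin n → ℕ) : ∃ u : kˣ, mon p a * mon p b = (u : k) • mon p (a + b) := by
  induction a using exponent_induction with
  | zero => exact ⟨1, by simp [mon_zero]⟩
  | add_single a i ih =>
    obtain ⟨u, hu⟩ := ih
    refine ⟨(leftFactor p i a)⁻¹ * (u * leftFactor p i (a + b)), ?_⟩
    rw [mon_add_single hdiag hskew, smul_mul_assoc, mul_assoc, hu, mul_smul_comm,
      X_mul_mon hdiag hskew, smul_smul, smul_smul, Units.val_mul, Units.val_mul, add_right_comm,
      mul_assoc]

variable (p) in
/-- The operator of left multiplication by `x_i` in the monomial basis. -/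
noncomputable def leftOp (i : Fin n) : Module.End k ((Fin n → ℕ) →₀ k) :=
  Finsupp.linearCombination k fun a =>
    (leftFactor p i a : k) • Finsupp.single (a + Pi.single i 1) (1 : k)

theorem leftOp_single (i : Fin n) (a : Fin n → ℕ) :
    leftOp p i (Finsupp.single a 1) =
      (leftFactor p i a : k) • Finsupp.single (a + Pi.single i 1) (1 : k) := by
  simp [leftOp]

-- This makes the operators a representation of A on the free module on exponents, which forces the
-- ordered monomials to be linearly independent. Just one factor depends on the order: x_j passes
-- x_i, never the reverse.
variable (p) in
theorem leftOp_mul_leftOp {i j : Fin n} (h : i < j) :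
    leftOp p j * leftOp p i = (p i j : k) • (leftOp p i * leftOp p j) := by
  refine Finsupp.lhom_ext' fun a => LinearMap.ext_ring ?_
  simp only [LinearMap.comp_apply, Finsupp.lsingle_apply, Module.End.mul_apply,
    LinearMap.smul_apply, leftOp_single, map_smul]
  rw [leftFactor_add_single_of_lt p h, leftFactor_add_single_of_not_lt p h.not_gt, add_right_comm,
    smul_smul, smul_smul, smul_smul]
  congr 1
  push_cast
  ring

variable (p) in
/-- The left regular representation in the monomial basis. -/
noncomputable def leftRep : SkewPoly p →ₐ[k] Module.End k ((Fin n → ℕ) →₀ k) :=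
  RingQuot.liftAlgHom k ⟨FreeAlgebra.lift k (leftOp p), by
    rintro _ _ ⟨i, j, h⟩
    simp [leftOp_mul_leftOp p h]⟩

theorem leftRep_X (i : Fin n) : leftRep p (X p i) = leftOp p i := by
  rw [leftRep, X, RingQuot.liftAlgHom_mkAlgHom_apply, FreeAlgebra.lift_ι_apply]

variable (p) in
/-- The coordinates in the monomial basis. -/
noncomputable def coords : SkewPoly p →ₗ[k] ((Fin n → ℕ) →₀ k) :=
  (LinearMap.applyₗ (Finsupp.single 0 1)).comp (leftRep p).toLinearMap

theorem coords_apply (f : SkewPoly p) : coords p f = leftRep p f (Finsupp.single 0 1) := rfl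

theorem coords_mon (hdiag : ∀ i, p i i = 1) (hskew : ∀ i j, p j i = (p i j)⁻¹)
    (a : Fin n → ℕ) : coords p (mon p a) = Finsupp.single a 1 := by
  induction a using exponent_induction with
  | zero => simp [coords_apply, mon_zero]
  | add_single a i ih =>
    rw [coords_apply] at ih
    rw [mon_add_single hdiag hskew, map_smul, coords_apply, map_mul, Module.End.mul_apply, ih,
      leftRep_X, leftOp_single, smul_smul, Units.inv_mul, one_smul]

/-- At `v = single 0 1` this says that `coords` followed by evaluation at monomials is the identity.
Arbitrary `v` is needed for the induction over products. -/
theorem linearCombination_leftRep (hdiag : ∀ i, p i i = 1) (hskew : ∀ i j, p j i = (p i j)⁻¹)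
    (f : SkewPoly p) (v : (Fin n → ℕ) →₀ k) :
    Finsupp.linearCombination k (mon p) (leftRep p f v) =
      f * Finsupp.linearCombination k (mon p) v := by
  obtain ⟨φ, rfl⟩ := RingQuot.mkAlgHom_surjective k (SkewRel p) f
  induction φ using FreeAlgebra.induction generalizing v with
  | grade0 r => simp [Algebra.algebraMap_eq_smul_one]
  | grade1 i =>
    change Finsupp.linearCombination k (mon p) (leftRep p (X p i) v) = X p i * _
    rw [leftRep_X]
    induction v using Finsupp.induction_linear with
    | zero => simp
    | add v w hv hw => rw [map_add, map_add, map_add, mul_add, hv, hw]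
    | single a c =>
      rw [← mul_one c, ← smul_eq_mul, ← Finsupp.smul_single, map_smul, map_smul, map_smul,
        leftOp_single, map_smul, Finsupp.linearCombination_single,
        Finsupp.linearCombination_single, one_smul, one_smul, mul_smul_comm,
        X_mul_mon hdiag hskew]
  | mul f g hf hg => rw [map_mul, map_mul, Module.End.mul_apply, hf, hg, mul_assoc]
  | add f g hf hg =>
    rw [map_add, map_add, LinearMap.add_apply, map_add, hf, hg, add_mul]

/-- The monomial basis of the skew polynomial ring. -/
noncomputable def monBasis (hdiag : ∀ i, p i i = 1) (hskew : ∀ i j, p j i = (p i j)⁻¹) :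
    Module.Basis (Fin n → ℕ) k (SkewPoly p) :=
  .ofRepr <| LinearEquiv.ofLinearMap (coords p) (Finsupp.linearCombination k (mon p))
    (Finsupp.lhom_ext' fun a => LinearMap.ext_ring <| by simp [coords_mon hdiag hskew])
    (LinearMap.ext fun f => by
      simp [coords_apply, linearCombination_leftRep hdiag hskew, mon_zero])

theorem monBasis_apply (hdiag : ∀ i, p i i = 1) (hskew : ∀ i j, p j i = (p i j)⁻¹)
    (a : Fin n → ℕ) : monBasis hdiag hskew a = mon p a := by
  simp [monBasis, Module.Basis.coe_ofRepr]

/-- The ordered monomials form a monomial basis of the skew polynomial ring. -/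
noncomputable def monomialBasis (hdiag : ∀ i, p i i = 1) (hskew : ∀ i j, p j i = (p i j)⁻¹) :
    MonomialBasis p (SkewPoly p) where
  basis := monBasis hdiag hskew
  basis_zero := by rw [monBasis_apply, mon_zero]
  cocycle a b := (exists_mon_mul_mon hdiag hskew a b).choose
  basis_mul a b := by
    simp only [monBasis_apply]
    exact (exists_mon_mul_mon hdiag hskew a b).choose_spec
  basis_comm i b := by
    simp only [monBasis_apply, mon_single hdiag hskew, X_mul_mon_comm hdiag hskew]

theorem monomialBasis_single (hdiag : ∀ i, p i i = 1) (hskew : ∀ i j, p j i = (p i j)⁻¹)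
    (i : Fin n) : (monomialBasis hdiag hskew).basis (Pi.single i 1) = X p i := by
  rw [← mon_single hdiag hskew i]
  exact monBasis_apply hdiag hskew _

end Skew

end SkewPoly

/-! ### Products, divisibility and centre in a monomial basis -/

namespace MonomialBasis

variable {k : Type*} [CommRing k] {n : ℕ} {p : Fin n → Fin n → kˣ} {A : Type*} [Ring A]
  [Algebra k A] (B : MonomialBasis p A)

@[elab_as_elim]
theorem induction_on {P : A → Prop} (f : A) (zero : P 0) (add : ∀ f g, P f → P g → P (f + g))
    (smul : ∀ (c : k) f, P f → P (c • f)) (basis : ∀ a, P (B.basis a)) : P f := by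
  have hf : f ∈ Submodule.span k (Set.range B.basis) := B.basis.mem_span f
  induction hf using Submodule.span_induction with
  | mem f hf => obtain ⟨a, rfl⟩ := hf; exact basis a
  | zero => exact zero
  | add f g _ _ hf hg => exact add f g hf hg
  | smul c f _ hf => exact smul c f hf

theorem repr_mul (f g : A) (e : Fin n → ℕ) :
    B.basis.repr (f * g) e = ∑ a ∈ (B.basis.repr f).support, ∑ b ∈ (B.basis.repr g).support,
      if a + b = e then B.basis.repr f a * B.basis.repr g b * (B.cocycle a b : k) else 0 := by
  conv_lhs => rw [← B.basis.linearCombination_repr f, ← B.basis.linearCombination_repr g]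
  rw [Finsupp.linearCombination_apply, Finsupp.linearCombination_apply, Finsupp.sum,
    Finsupp.sum, Finset.sum_mul_sum, map_sum, Finsupp.finsetSum_apply]
  refine Finset.sum_congr rfl fun a _ => ?_
  rw [map_sum, Finsupp.finsetSum_apply]
  refine Finset.sum_congr rfl fun b _ => ?_
  rw [smul_mul_smul_comm, B.basis_mul, smul_smul, map_smul, B.basis.repr_self,
    Finsupp.smul_apply, Finsupp.single_apply, smul_eq_mul, mul_ite, mul_one, mul_zero]

theorem exists_add_eq_of_repr_mul_ne_zero {f g : A} {e : Fin n → ℕ}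
    (h : B.basis.repr (f * g) e ≠ 0) :
    ∃ a b, B.basis.repr f a ≠ 0 ∧ B.basis.repr g b ≠ 0 ∧ a + b = e := by
  rw [B.repr_mul] at h
  obtain ⟨a, ha, h⟩ := Finset.exists_ne_zero_of_sum_ne_zero h
  obtain ⟨b, hb, h⟩ := Finset.exists_ne_zero_of_sum_ne_zero h
  refine ⟨a, b, Finsupp.mem_support_iff.mp ha, Finsupp.mem_support_iff.mp hb, ?_⟩
  by_contra hab
  exact h (if_neg hab)

/-- A stand-in for leading coefficients: no monomial order is needed, only a sum of exponents
attained once. -/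
theorem repr_mul_of_unique {f g : A} {a b : Fin n → ℕ} (ha : B.basis.repr f a ≠ 0)
    (hb : B.basis.repr g b ≠ 0)
    (h : ∀ a' b', B.basis.repr f a' ≠ 0 → B.basis.repr g b' ≠ 0 → a' + b' = a + b →
      a' = a ∧ b' = b) :
    B.basis.repr (f * g) (a + b) =
      B.basis.repr f a * B.basis.repr g b * (B.cocycle a b : k) := by
  rw [B.repr_mul, Finset.sum_eq_single a, Finset.sum_eq_single b, if_pos rfl]
  · intro b' hb' hne
    exact if_neg fun he => hne (h a b' ha (Finsupp.mem_support_iff.mp hb') he).2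
  · intro hb'; exact absurd (Finsupp.mem_support_iff.mpr hb) hb'
  · intro a' ha' hne
    refine Finset.sum_eq_zero fun b' hb' => if_neg fun he => hne ?_
    exact (h a' b' (Finsupp.mem_support_iff.mp ha') (Finsupp.mem_support_iff.mp hb') he).1
  · intro ha'; exact absurd (Finsupp.mem_support_iff.mpr ha) ha'

theorem repr_basis_mul (a : Fin n → ℕ) (g : A) (b : Fin n → ℕ) :
    B.basis.repr (B.basis a * g) (a + b) = B.basis.repr g b * (B.cocycle a b : k) := by
  conv_lhs => rw [← B.basis.linearCombination_repr g]
  rw [Finsupp.linearCombination_apply, Finsupp.sum, Finset.mul_sum, map_sum,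
    Finsupp.finsetSum_apply]
  simp only [mul_smul_comm, B.basis_mul, smul_smul, map_smul, B.basis.repr_self,
    Finsupp.smul_apply, Finsupp.single_apply, add_right_inj, smul_eq_mul, mul_ite, mul_one,
    mul_zero]
  rw [Finset.sum_ite_eq']
  split_ifs with h
  · rfl
  · rw [Finsupp.notMem_support_iff.mp h, zero_mul]

theorem repr_mul_basis (f : A) (a b : Fin n → ℕ) :
    B.basis.repr (f * B.basis b) (a + b) = B.basis.repr f a * (B.cocycle a b : k) := by
  conv_lhs => rw [← B.basis.linearCombination_repr f]
  rw [Finsupp.linearCombination_apply, Finsupp.sum, Finset.sum_mul, map_sum,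
    Finsupp.finsetSum_apply]
  simp only [smul_mul_assoc, B.basis_mul, smul_smul, map_smul, B.basis.repr_self,
    Finsupp.smul_apply, Finsupp.single_apply, add_left_inj, smul_eq_mul, mul_ite, mul_one,
    mul_zero]
  rw [Finset.sum_ite_eq']
  split_ifs with h
  · rfl
  · rw [Finsupp.notMem_support_iff.mp h, zero_mul]

theorem basis_add (a b : Fin n → ℕ) :
    B.basis (a + b) = (((B.cocycle a b)⁻¹ : kˣ) : k) • (B.basis a * B.basis b) := by
  rw [B.basis_mul, smul_smul, Units.inv_mul, one_smul]

theorem exists_basis_mul_comm (a b : Fin n → ℕ) :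
    ∃ u : kˣ, B.basis a * B.basis b = (u : k) • (B.basis b * B.basis a) := by
  refine ⟨B.cocycle a b * (B.cocycle b a)⁻¹, ?_⟩
  rw [B.basis_mul, B.basis_mul, smul_smul, add_comm b a, Units.val_mul, mul_assoc, Units.inv_mul,
    mul_one]

theorem isNormalElt_smul_basis (c : k) (a : Fin n → ℕ) : IsNormalElt (c • B.basis a) := by
  constructor
  · intro b
    induction b using B.induction_on with
    | zero => exact ⟨0, by simp⟩
    | add b b' hb hb' =>
      obtain ⟨d, hd⟩ := hb
      obtain ⟨d', hd'⟩ := hb'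
      exact ⟨d + d', by rw [mul_add, add_mul, hd, hd']⟩
    | smul r b hb =>
      obtain ⟨d, hd⟩ := hb
      exact ⟨r • d, by rw [mul_smul_comm r, smul_mul_assoc r, hd]⟩
    | basis b =>
      obtain ⟨u, hu⟩ := B.exists_basis_mul_comm a b
      refine ⟨(u : k) • B.basis b, ?_⟩
      rw [smul_mul_assoc, hu, smul_mul_assoc, mul_smul_comm, smul_comm]
  · intro b
    induction b using B.induction_on with
    | zero => exact ⟨0, by simp⟩
    | add b b' hb hb' =>
      obtain ⟨d, hd⟩ := hb
      obtain ⟨d', hd'⟩ := hb'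
      exact ⟨d + d', by rw [mul_add, add_mul, hd, hd']⟩
    | smul r b hb =>
      obtain ⟨d, hd⟩ := hb
      exact ⟨r • d, by rw [mul_smul_comm r, smul_mul_assoc r, hd]⟩
    | basis b =>
      obtain ⟨u, hu⟩ := B.exists_basis_mul_comm b a
      refine ⟨(u : k) • B.basis b, ?_⟩
      rw [smul_mul_assoc, mul_smul_comm, mul_smul_comm, hu, smul_comm]

theorem basis_mem_center {a : Fin n → ℕ} (ha : commFactor p a = 1) :
    B.basis a ∈ Subring.center A := by
  rw [Subring.mem_center_iff]
  have key : ∀ b, B.basis b * B.basis a = B.basis a * B.basis b := by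
    intro b
    induction b using exponent_induction with
    | zero => rw [B.basis_zero, one_mul, mul_one]
    | add_single b i ih =>
      have hi := B.basis_comm i a
      rw [ha, Pi.one_apply, inv_one, Units.val_one, one_smul] at hi
      rw [B.basis_add, smul_mul_assoc, mul_smul_comm, mul_assoc, hi, ← mul_assoc, ih, mul_assoc]
  intro g
  induction g using B.induction_on with
  | zero => simp
  | add g g' hg hg' => rw [add_mul, mul_add, hg, hg']
  | smul r g hg => rw [smul_mul_assoc, mul_smul_comm, hg]
  | basis b => exact key b

theorem smul_mem_center {a : A} (c : k) (ha : a ∈ Subring.center A) :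
    c • a ∈ Subring.center A := by
  rw [Subring.mem_center_iff] at ha ⊢
  intro g
  rw [mul_smul_comm, ha, smul_mul_assoc]

theorem eq_smul_basis_of_support_eq {f : A} {a : Fin n → ℕ}
    (h : (B.basis.repr f).support = {a}) : f = B.basis.repr f a • B.basis a := by
  conv_lhs => rw [← B.basis.linearCombination_repr f]
  rw [Finsupp.linearCombination_apply, Finsupp.sum, h, Finset.sum_singleton]

section Domain

variable [IsDomain k]

-- Exponent vectors have the unique sums property: two nonempty finite supports have a sum attained
-- once, whose coefficient in the product is nonzero.
include B in
theorem isDomain : IsDomain A := by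
  have : Nontrivial A := ⟨⟨1, 0, by rw [← B.basis_zero]; exact B.basis.ne_zero 0⟩⟩
  have : NoZeroDivisors A := ⟨by
    intro f g hfg
    by_contra! h
    have hf : (B.basis.repr f).support.Nonempty := by simpa using h.1
    have hg : (B.basis.repr g).support.Nonempty := by simpa using h.2
    obtain ⟨a, ha, b, hb, hu⟩ := UniqueSums.uniqueAdd_of_nonempty hf hg
    have ha := Finsupp.mem_support_iff.mp ha
    have hb := Finsupp.mem_support_iff.mp hb
    have := B.repr_mul_of_unique ha hb fun a' b' ha' hb' =>
      hu (Finsupp.mem_support_iff.mpr ha') (Finsupp.mem_support_iff.mpr hb')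
    rw [hfg, map_zero, Finsupp.zero_apply] at this
    exact mul_ne_zero (mul_ne_zero ha hb) (Units.ne_zero _) this.symm⟩
  exact NoZeroDivisors.to_isDomain A

/-- Every uniquely attained sum of exponents survives in the product, so equals `e`. If the supports
were not both singletons, there would be two distinct pairs with uniquely attained sums; both sums
would be `e`, against uniqueness. -/
theorem factors_of_mul_eq_smul_basis {f g : A} {c : k} (hc : c ≠ 0) {e : Fin n → ℕ}
    (h : f * g = c • B.basis e) :
    ∃ (c₁ c₂ : k) (a b : Fin n → ℕ), f = c₁ • B.basis a ∧ g = c₂ • B.basis b ∧ a + b = e ∧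
      c₁ * c₂ * B.cocycle a b = c := by
  have hrepr : B.basis.repr (f * g) = Finsupp.single e c := by
    rw [h, map_smul, B.basis.repr_self, Finsupp.smul_single_one]
  have hunique : ∀ a ∈ (B.basis.repr f).support, ∀ b ∈ (B.basis.repr g).support,
      UniqueAdd (B.basis.repr f).support (B.basis.repr g).support a b → a + b = e := by
    intro a ha b hb hu
    by_contra hne
    have ha := Finsupp.mem_support_iff.mp ha
    have hb := Finsupp.mem_support_iff.mp hb
    have := B.repr_mul_of_unique ha hb fun a' b' ha' hb' =>
      hu (Finsupp.mem_support_iff.mpr ha') (Finsupp.mem_support_iff.mpr hb')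
    rw [hrepr, Finsupp.single_eq_of_ne hne] at this
    exact mul_ne_zero (mul_ne_zero ha hb) (Units.ne_zero _) this.symm
  have hf : (B.basis.repr f).support.Nonempty := by
    rw [Finsupp.support_nonempty_iff]
    intro hf
    rw [LinearEquiv.map_eq_zero_iff] at hf
    rw [hf, zero_mul, map_zero] at hrepr
    exact hc (Finsupp.single_eq_zero.mp hrepr.symm)
  have hg : (B.basis.repr g).support.Nonempty := by
    rw [Finsupp.support_nonempty_iff]
    intro hg
    rw [LinearEquiv.map_eq_zero_iff] at hg
    rw [hg, mul_zero, map_zero] at hrepr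
    exact hc (Finsupp.single_eq_zero.mp hrepr.symm)
  have hcard : (B.basis.repr f).support.card * (B.basis.repr g).support.card ≤ 1 := by
    by_contra! hlt
    obtain ⟨q, hq, r, hr, hne, hqu, hru⟩ := TwoUniqueSums.uniqueAdd_of_one_lt_card hlt
    rw [Finset.mem_product] at hq hr
    have h1 := hunique _ hq.1 _ hq.2 hqu
    have h2 := hunique _ hr.1 _ hr.2 hru
    obtain ⟨h3, h4⟩ := hru hq.1 hq.2 (h1.trans h2.symm)
    exact hne (Prod.ext h3 h4)
  have hf1 := Finset.card_pos.mpr hf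
  have hg1 := Finset.card_pos.mpr hg
  obtain ⟨a, ha⟩ := Finset.card_eq_one.mp (show (B.basis.repr f).support.card = 1 by nlinarith)
  obtain ⟨b, hb⟩ := Finset.card_eq_one.mp (show (B.basis.repr g).support.card = 1 by nlinarith)
  have hfa := B.eq_smul_basis_of_support_eq ha
  have hgb := B.eq_smul_basis_of_support_eq hb
  have hu : UniqueAdd (B.basis.repr f).support (B.basis.repr g).support a b := by
    rw [ha, hb]
    intro a' b' ha' hb' _
    exact ⟨Finset.mem_singleton.mp ha', Finset.mem_singleton.mp hb'⟩
  have hab := hunique a (by simp [ha]) b (by simp [hb]) hu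
  refine ⟨_, _, a, b, hfa, hgb, hab, ?_⟩
  have := congrArg (fun x => B.basis.repr x e) h
  simp only [map_smul, B.basis.repr_self, Finsupp.smul_single_one, Finsupp.single_eq_same] at this
  rw [← this, ← hab]
  refine (B.repr_mul_of_unique (Finsupp.mem_support_iff.mp (by simp [ha]))
    (Finsupp.mem_support_iff.mp (by simp [hb])) fun a' b' ha' hb' => ?_).symm
  exact hu (Finsupp.mem_support_iff.mpr ha') (Finsupp.mem_support_iff.mpr hb')

theorem nDvd_smul_basis_iff {c c' : k} (hc : c' ≠ 0) {a b : Fin n → ℕ} :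
    NDvd (c • B.basis a) (c' • B.basis b) ↔ c ∣ c' ∧ a ≤ b := by
  constructor
  · rintro ⟨f, hf⟩
    obtain ⟨c₁, c₂, a₁, a₂, h₁, h₂, hab, hcc⟩ := B.factors_of_mul_eq_smul_basis hc hf.symm
    have hc₂ : c₂ ≠ 0 := by
      rintro rfl; exact hc (by rw [← hcc, mul_zero, zero_mul])
    have hsingle := congrArg B.basis.repr h₂
    rw [map_smul, map_smul, B.basis.repr_self, B.basis.repr_self, Finsupp.smul_single_one,
      Finsupp.smul_single_one] at hsingle
    rcases (Finsupp.single_eq_single_iff _ _ _ _).mp hsingle with ⟨rfl, rfl⟩ | ⟨_, h0⟩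
    · exact ⟨⟨c₁ * B.cocycle a₁ a, by rw [← hcc]; ring⟩, hab ▸ le_add_self⟩
    · exact absurd h0 hc₂
  · rintro ⟨⟨d, rfl⟩, hab⟩
    refine ⟨(d * ((B.cocycle (b - a) a)⁻¹ : kˣ)) • B.basis (b - a), ?_⟩
    rw [smul_mul_smul_comm, B.basis_mul, tsub_add_cancel_of_le hab, smul_smul]
    congr 1
    rw [mul_right_comm, mul_assoc d, Units.inv_mul, mul_one, mul_comm]

theorem exists_eq_smul_basis_of_nDvd {f : A} {c : k} (hc : c ≠ 0) {e : Fin n → ℕ}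
    (h : NDvd f (c • B.basis e)) : ∃ (c' : k) (a : Fin n → ℕ), f = c' • B.basis a := by
  obtain ⟨g, hg⟩ := h
  obtain ⟨_, c₂, _, b, _, h₂, _⟩ := B.factors_of_mul_eq_smul_basis hc hg.symm
  exact ⟨c₂, b, h₂⟩

/-- Compare the coefficients of x_i z and z x_i at `e_i + a`. Cancelling the coefficient of `z` at
`a` shows that x_i and x^a commute. -/
theorem commFactor_eq_one_of_mem_center {z : A} (hz : z ∈ Subring.center A) {a : Fin n → ℕ}
    (ha : B.basis.repr z a ≠ 0) : commFactor p a = 1 := by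
  funext i
  have hcomm := Subring.mem_center_iff.mp hz (B.basis (Pi.single i 1))
  have h1 := B.repr_basis_mul (Pi.single i 1) z a
  rw [hcomm, add_comm, B.repr_mul_basis] at h1
  have h2 : B.cocycle a (Pi.single i 1) = B.cocycle (Pi.single i 1) a :=
    Units.ext (mul_left_cancel₀ ha h1)
  have h3 := B.basis_comm i a
  rw [B.basis_mul, B.basis_mul, smul_smul, h2, add_comm a] at h3
  have h4 := congrArg (fun x => B.basis.repr x (Pi.single i 1 + a)) h3
  simp only [map_smul, B.basis.repr_self, Finsupp.smul_single_one, Finsupp.single_eq_same] at h4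
  rw [← Units.val_mul, Units.val_inj, right_eq_mul, inv_eq_one] at h4
  exact h4

end Domain

end MonomialBasis

/-! ### The finite group of commutation tuples -/

section CommFactor

variable {k : Type*} [CommRing k] {n : ℕ} {p : Fin n → Fin n → kˣ}

theorem exists_pos_forall_pow_eq_one (hfin : ∀ i j, IsOfFinOrder (p i j)) :
    ∃ N : ℕ, 0 < N ∧ ∀ i j, p i j ^ N = 1 := by
  refine ⟨∏ i, ∏ j, orderOf (p i j),
    Finset.prod_pos fun i _ => Finset.prod_pos fun j _ => (hfin i j).orderOf_pos, fun i j => ?_⟩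
  rw [← orderOf_dvd_iff_pow_eq_one]
  exact (Finset.dvd_prod_of_mem _ (Finset.mem_univ j)).trans
    (Finset.dvd_prod_of_mem (fun i => ∏ j, orderOf (p i j)) (Finset.mem_univ i))

theorem exists_commFactor_add_eq_one (hfin : ∀ i j, IsOfFinOrder (p i j)) (a : Fin n → ℕ) :
    ∃ a', commFactor p (a' + a) = 1 := by
  obtain ⟨N, hN, hp⟩ := exists_pos_forall_pow_eq_one hfin
  -- Exponents cannot be negated, but modulo `N` the vector `(N - 1) • a` acts as `-a`.
  refine ⟨(N - 1) • a, ?_⟩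
  rw [← succ_nsmul, Nat.sub_add_cancel hN]
  funext i
  refine Finset.prod_eq_one fun j _ => ?_
  rw [Pi.smul_apply, smul_eq_mul, pow_mul, hp, one_pow]

theorem finite_range_commFactor (hfin : ∀ i j, IsOfFinOrder (p i j)) :
    (Set.range (commFactor p)).Finite := by
  obtain ⟨N, hN, hp⟩ := exists_pos_forall_pow_eq_one hfin
  have : (Set.range (commFactor p)) ⊆
      commFactor p '' {f | ∀ j, f j ∈ Set.Iio N} := by
    rintro _ ⟨a, rfl⟩
    refine ⟨fun j => a j % N, fun j => Nat.mod_lt _ hN, ?_⟩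
    funext i
    exact Finset.prod_congr rfl fun j _ => (pow_eq_pow_mod _ (hp i j)).symm
  exact ((Set.Finite.pi' fun _ => Set.finite_Iio N).image _).subset this

/-- The order of the finite group of all commutation tuples is nonzero in the domain `k`. -/
theorem card_range_commFactor_ne_zero [IsDomain k] (hfin : ∀ i j, IsOfFinOrder (p i j)) :
    ((Nat.card (Set.range (commFactor p)) : ℕ) : k) ≠ 0 := by
  let G : Subgroup (Fin n → kˣ) :=
    { carrier := Set.range (commFactor p)
      one_mem' := ⟨0, commFactor_zero p⟩
      mul_mem' := by
        rintro _ _ ⟨a, rfl⟩ ⟨b, rfl⟩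
        exact ⟨a + b, commFactor_add p a b⟩
      inv_mem' := by
        rintro _ ⟨a, rfl⟩
        obtain ⟨a', ha'⟩ := exists_commFactor_add_eq_one hfin a
        exact ⟨a', eq_inv_of_mul_eq_one_left (by rw [← commFactor_add, ha'])⟩ }
  have : Finite G := (finite_range_commFactor hfin).to_subtype
  change ((Nat.card G : ℕ) : k) ≠ 0
  intro h0
  obtain ⟨q, hq⟩ := CharP.exists k
  have hdvd : q ∣ Nat.card G := (CharP.cast_eq_zero_iff k q _).mp h0
  rcases CharP.char_is_prime_or_zero k q with hprime | rfl
  · have := Fact.mk hprime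
    -- Cauchy gives an element of order `q`; in characteristic `q` each coordinate satisfies (x -
    -- 1)^q = x^q - 1 = 0, hence equals 1.
    obtain ⟨g, hg⟩ := exists_prime_orderOf_dvd_card' q hdvd
    have hg1 : g = 1 := by
      refine Subtype.ext (funext fun i => Units.ext ?_)
      have h1 : g ^ q = 1 := by rw [← hg, pow_orderOf_eq_one]
      have h2 : (((g : Fin n → kˣ) i : kˣ) : k) ^ q = 1 := by
        have := congrArg (fun x : G => (((x : Fin n → kˣ) i : kˣ) : k)) h1
        simpa using this
      have h3 : ((((g : Fin n → kˣ) i : kˣ) : k) - 1) ^ q = 0 := by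
        rw [sub_pow_char, h2, one_pow, sub_self]
      exact sub_eq_zero.mp (pow_eq_zero_iff hprime.ne_zero |>.mp h3)
    rw [hg1, orderOf_one] at hg
    exact hprime.one_lt.ne hg
  · exact Nat.card_pos.ne' (zero_dvd_iff.mp hdvd)

end CommFactor

/-! ### The regular trace over the centre -/

section RegTrace

variable {A : Type*} [Ring A]

/-- The regular trace as a linear map over the centre. -/
noncomputable def regTraceLinear : A →ₗ[Subring.center A] CenterFrac A where
  toFun := regTrace
  map_add' a b := by
    rw [regTrace, regTrace, regTrace, ← map_add]
    congr 1
    ext x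
    simp [TensorProduct.tmul_add, add_mul]
  map_smul' z a := by
    rw [RingHom.id_apply, ← algebraMap_smul (CenterFrac A) z (regTrace a), regTrace, regTrace,
      ← map_smul]
    congr 1
    rw [TensorProduct.tmul_smul, ← algebraMap_smul (CenterFrac A) z]
    exact LinearMap.ext fun x => smul_mul_assoc _ _ _

theorem regTraceLinear_apply (a : A) : regTraceLinear a = regTrace a := rfl

theorem regTrace_of_mem_center [Nontrivial (CenterFrac A)]
    [Module.Free (CenterFrac A) (CenterLoc A)] [Module.Finite (CenterFrac A) (CenterLoc A)]
    (z : Subring.center A) :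
    regTrace (z : A) = algebraMap _ (CenterFrac A) z * (centerRank A : CenterFrac A) := by
  have h : LinearMap.mulLeft (CenterFrac A) (1 ⊗ₜ[Subring.center A] (z : A) : CenterLoc A) =
      algebraMap _ (CenterFrac A) z • LinearMap.id := by
    ext x
    have : (z : A) = z • (1 : A) := by rw [Algebra.smul_def, mul_one]; rfl
    rw [this, TensorProduct.tmul_smul, ← algebraMap_smul (CenterFrac A) z]
    simp [← Algebra.TensorProduct.one_def]
  rw [regTrace, h, map_smul, LinearMap.trace_id, smul_eq_mul, centerRank]

end RegTrace

/-! ### Rank over the centre and traces of monomials -/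

namespace MonomialBasis

variable {k : Type*} [CommRing k] {n : ℕ} {p : Fin n → Fin n → kˣ} {A : Type*} [Ring A]
  [Algebra k A] (B : MonomialBasis p A)

theorem center_smul_def (z : Subring.center A) (a : A) : z • a = (z : A) * a := rfl

/-- With x^{a'} of the inverse class, both x^{a'+b} x^a and x^{a'+a} x^b are unit multiples of
x^{a'+a+b}, and the left factors are central; the inverse cocycles equalise the units. -/
theorem exists_center_smul_eq (hfin : ∀ i j, IsOfFinOrder (p i j)) [Nontrivial k]
    {a b : Fin n → ℕ} (h : commFactor p a = commFactor p b) :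
    ∃ z₁ z₂ : Subring.center A, z₁ ≠ 0 ∧ z₂ ≠ 0 ∧ z₁ • B.basis a = z₂ • B.basis b := by
  obtain ⟨a', ha'⟩ := exists_commFactor_add_eq_one hfin a
  have hb' : commFactor p (a' + b) = 1 := by rw [commFactor_add, ← h, ← commFactor_add, ha']
  have hne : ∀ (u : kˣ) e, (u : k) • B.basis e ≠ 0 := fun u e he =>
    B.basis.ne_zero e (by
      rw [← one_smul k (B.basis e), ← Units.inv_mul u, mul_smul, he, smul_zero])
  refine ⟨⟨(((B.cocycle (a' + b) a)⁻¹ : kˣ) : k) • B.basis (a' + b),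
    smul_mem_center _ (B.basis_mem_center hb')⟩,
    ⟨(((B.cocycle (a' + a) b)⁻¹ : kˣ) : k) • B.basis (a' + a),
    smul_mem_center _ (B.basis_mem_center ha')⟩, ?_, ?_, ?_⟩
  · rw [Ne, Subtype.ext_iff]; exact hne _ _
  · rw [Ne, Subtype.ext_iff]; exact hne _ _
  · rw [center_smul_def, center_smul_def, smul_mul_assoc, smul_mul_assoc, ← basis_add,
      ← basis_add, add_right_comm]

theorem not_linearIndependent_of_commFactor_eq (hfin : ∀ i j, IsOfFinOrder (p i j))
    [Nontrivial k] {ι : Type*} {a : ι → Fin n → ℕ} {i j : ι} (hij : i ≠ j)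
    (h : commFactor p (a i) = commFactor p (a j)) :
    ¬ LinearIndependent (Subring.center A) fun i => B.basis (a i) := by
  intro hli
  obtain ⟨z₁, z₂, h₁, _, hz⟩ := B.exists_center_smul_eq hfin h
  have := (LinearIndepOn.pair_iff _ hij).mp (hli.linearIndepOn (s := {i, j})) z₁ (-z₂)
    (by rw [hz, neg_smul, add_neg_cancel])
  exact h₁ this.1

variable [IsDomain k]

/-- Central coefficients involve only exponents of trivial class, so each summand stays in the class
of its own monomial and different summands share no exponent. -/
theorem linearIndependent_of_commFactor_injective {ι : Type*} {a : ι → Fin n → ℕ}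
    (ha : Function.Injective fun i => commFactor p (a i)) :
    LinearIndependent (Subring.center A) fun i => B.basis (a i) := by
  rw [linearIndependent_iff']
  intro s g hg i hi
  by_contra hne
  have hne' : (B.basis.repr (g i : A)) ≠ 0 := by simpa using hne
  obtain ⟨e, he⟩ := Finsupp.ne_iff.mp hne'
  rw [Finsupp.zero_apply] at he
  have h := congrArg (fun x => B.basis.repr x (e + a i)) hg
  simp only [map_sum, map_zero, Finsupp.zero_apply, Finsupp.finsetSum_apply] at h
  rw [Finset.sum_eq_single_of_mem i hi, center_smul_def, B.repr_mul_basis] at h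
  · exact mul_ne_zero he (Units.ne_zero _) h
  · intro j _ hj
    by_contra hj0
    obtain ⟨e', b, he', hb, hsum⟩ := B.exists_add_eq_of_repr_mul_ne_zero hj0
    have hb' : a j = b := by
      by_contra hb'
      rw [B.basis.repr_self, Finsupp.single_eq_of_ne (Ne.symm hb')] at hb
      exact hb rfl
    subst hb'
    have := congrArg (commFactor p) hsum
    rw [commFactor_add, commFactor_add, B.commFactor_eq_one_of_mem_center (g j).2 he',
      B.commFactor_eq_one_of_mem_center (g i).2 he, one_mul, one_mul] at this
    exact hj (ha this)

omit [IsDomain k] in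
theorem span_center_range_basis :
    Submodule.span (Subring.center A) (Set.range B.basis) = ⊤ := by
  refine eq_top_iff.mpr fun f _ => ?_
  induction f using B.induction_on with
  | zero => exact zero_mem _
  | add f g hf hg => exact add_mem (hf trivial) (hg trivial)
  | smul c f hf =>
    have : c • f = (⟨c • (1 : A), smul_mem_center c (one_mem _)⟩ : Subring.center A) • f := by
      rw [center_smul_def, smul_mul_assoc, one_mul]
    rw [this]
    exact Submodule.smul_mem _ _ (hf trivial)
  | basis a => exact Submodule.subset_span ⟨a, rfl⟩

omit [IsDomain k] in
theorem exists_smul_tmul_eq (hfin : ∀ i j, IsOfFinOrder (p i j)) [IsDomain A] [Nontrivial k]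
    {a b : Fin n → ℕ} (h : commFactor p a = commFactor p b) :
    ∃ f : CenterFrac A, (1 ⊗ₜ[Subring.center A] B.basis a : CenterLoc A) =
      f • (1 ⊗ₜ[Subring.center A] B.basis b) := by
  obtain ⟨z₁, z₂, h₁, _, hz⟩ := B.exists_center_smul_eq hfin h
  obtain ⟨u, hu⟩ := IsLocalization.map_units (CenterFrac A)
    (⟨z₁, mem_nonZeroDivisors_of_ne_zero h₁⟩ : nonZeroDivisors (Subring.center A))
  refine ⟨(↑u⁻¹ : CenterFrac A) * algebraMap _ _ z₂, ?_⟩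
  rw [mul_smul, algebraMap_smul, ← TensorProduct.tmul_smul, ← hz, TensorProduct.tmul_smul,
    ← algebraMap_smul (CenterFrac A) z₁, ← hu, smul_smul, Units.inv_mul, one_smul]

/-- Representatives of the classes of monomials modulo the centre. -/
noncomputable def rep (g : Set.range (commFactor p)) : Fin n → ℕ := g.2.choose

omit [IsDomain k] in
theorem commFactor_rep (g : Set.range (commFactor p)) : commFactor p (rep g) = g :=
  g.2.choose_spec

/-- Both independence and spanning pass from A over its centre to the localisation; proportionality
within a class then leaves one monomial per class. -/
theorem exists_basis_centerLoc (hfin : ∀ i j, IsOfFinOrder (p i j)) :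
    ∃ b : Module.Basis (Set.range (commFactor p)) (CenterFrac A) (CenterLoc A),
      ∀ g, b g = 1 ⊗ₜ[Subring.center A] B.basis (rep g) := by
  have := B.isDomain
  have hli : LinearIndependent (CenterFrac A)
      (TensorProduct.mk (Subring.center A) (CenterFrac A) A 1 ∘
        fun g : Set.range (commFactor p) => B.basis (rep g)) :=
    LinearIndependent.of_isLocalizedModule (CenterFrac A) (nonZeroDivisors (Subring.center A)) _
      (B.linearIndependent_of_commFactor_injective fun g g' h => by
        simp only [commFactor_rep] at h
        exact Subtype.ext h)
  refine ⟨.mk hli ?_, fun g => Module.Basis.mk_apply _ _ _⟩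
  rw [← span_eq_top_of_isLocalizedModule (CenterFrac A) (nonZeroDivisors (Subring.center A))
    (TensorProduct.mk (Subring.center A) (CenterFrac A) A 1) B.span_center_range_basis,
    Submodule.span_le]
  rintro _ ⟨_, ⟨a, rfl⟩, rfl⟩
  obtain ⟨f, hf⟩ := B.exists_smul_tmul_eq hfin (commFactor_rep ⟨_, a, rfl⟩).symm
  rw [TensorProduct.mk_apply, hf]
  exact Submodule.smul_mem _ _ (Submodule.subset_span ⟨_, rfl⟩)

include B in
theorem finite_centerLoc (hfin : ∀ i j, IsOfFinOrder (p i j)) :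
    Module.Finite (CenterFrac A) (CenterLoc A) := by
  obtain ⟨b, -⟩ := B.exists_basis_centerLoc hfin
  have := (finite_range_commFactor hfin).to_subtype
  exact Module.Finite.of_basis b

include B in
theorem free_centerLoc (hfin : ∀ i j, IsOfFinOrder (p i j)) :
    Module.Free (CenterFrac A) (CenterLoc A) :=
  Module.Free.of_basis (B.exists_basis_centerLoc hfin).choose

include B in
theorem centerRank_eq (hfin : ∀ i j, IsOfFinOrder (p i j)) :
    centerRank A = Nat.card (Set.range (commFactor p)) := by
  have := B.isDomain
  obtain ⟨b, -⟩ := B.exists_basis_centerLoc hfin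
  exact Module.finrank_eq_nat_card_basis b

include B in
theorem centerRank_ne_zero (hfin : ∀ i j, IsOfFinOrder (p i j)) : (centerRank A : k) ≠ 0 := by
  rw [B.centerRank_eq hfin]
  exact card_range_commFactor_ne_zero hfin

/-- Multiplication by x^a sends the basis vector of class g to a multiple of that of class
`commFactor p a * g ≠ g`, so the diagonal of its matrix is zero. -/
theorem regTrace_basis_of_commFactor_ne_one (hfin : ∀ i j, IsOfFinOrder (p i j))
    {a : Fin n → ℕ} (ha : commFactor p a ≠ 1) : regTrace (B.basis a) = 0 := by
  classical
  have := B.isDomain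
  have := (finite_range_commFactor hfin).to_subtype
  have := Fintype.ofFinite (Set.range (commFactor p))
  obtain ⟨b, hb⟩ := B.exists_basis_centerLoc hfin
  rw [regTrace, LinearMap.trace_eq_matrix_trace _ b, Matrix.trace]
  refine Finset.sum_eq_zero fun g _ => ?_
  rw [Matrix.diag_apply, LinearMap.toMatrix_apply, hb, LinearMap.mulLeft_apply,
    Algebra.TensorProduct.tmul_mul_tmul, one_mul, B.basis_mul]
  obtain ⟨f, hf⟩ := B.exists_smul_tmul_eq hfin (commFactor_rep ⟨_, a + rep g, rfl⟩).symm
  have hc : (B.cocycle a (rep g) : k) • B.basis (a + rep g) =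
      (⟨(B.cocycle a (rep g) : k) • (1 : A), smul_mem_center _ (one_mem _)⟩ :
        Subring.center A) • B.basis (a + rep g) := by
    rw [center_smul_def, smul_mul_assoc, one_mul]
  rw [hc, TensorProduct.tmul_smul, hf, ← hb, ← algebraMap_smul (CenterFrac A), map_smul, map_smul,
    b.repr_self, Finsupp.smul_apply, Finsupp.smul_apply, Finsupp.single_eq_of_ne, smul_zero,
    smul_zero]
  intro h
  have h := congrArg Subtype.val h
  simp only [commFactor_add, commFactor_rep] at h
  exact ha (by simpa using h)

theorem regTrace_basis_of_commFactor_eq_one (hfin : ∀ i j, IsOfFinOrder (p i j))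
    {a : Fin n → ℕ} (ha : commFactor p a = 1) :
    regTrace (B.basis a) = algebraMap (Subring.center A) (CenterFrac A)
      ⟨(centerRank A : k) • B.basis a, smul_mem_center _ (B.basis_mem_center ha)⟩ := by
  have := B.isDomain
  have := B.free_centerLoc hfin
  have := B.finite_centerLoc hfin
  rw [regTrace_of_mem_center ⟨B.basis a, B.basis_mem_center ha⟩, ← map_natCast
    (algebraMap (Subring.center A) (CenterFrac A)), ← map_mul]
  congr 1
  refine Subtype.ext ?_
  simp only [Subring.coe_mul, Subring.coe_natCast, Nat.cast_smul_eq_nsmul, nsmul_eq_mul]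
  exact (Nat.cast_comm _ _).symm

include B in
theorem exists_algebraMap_eq_regTrace (hfin : ∀ i j, IsOfFinOrder (p i j)) (a : A) :
    ∃ c : Subring.center A, algebraMap _ (CenterFrac A) c = regTrace a := by
  have ha : a ∈ (LinearMap.range (Algebra.linearMap (Subring.center A) (CenterFrac A))).comap
      regTraceLinear := by
    have : (⊤ : Submodule (Subring.center A) A) ≤
        (LinearMap.range (Algebra.linearMap (Subring.center A) (CenterFrac A))).comap
          regTraceLinear := by
      rw [← B.span_center_range_basis, Submodule.span_le]
      rintro _ ⟨e, rfl⟩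
      by_cases he : commFactor p e = 1
      · exact ⟨_, (B.regTrace_basis_of_commFactor_eq_one hfin he).symm⟩
      · exact ⟨0, by rw [map_zero]; exact (B.regTrace_basis_of_commFactor_ne_one hfin he).symm⟩
    exact this trivial
  exact ha

end MonomialBasis

/-! ### Multilinearity of pair discriminants -/

theorem MultilinearMap.mem_of_forall_mem_of_span_eq_top {R M N ι : Type*} [CommRing R]
    [AddCommGroup M] [Module R M] [AddCommGroup N] [Module R N] [Finite ι]
    (g : MultilinearMap R (fun _ : ι => M) N) {S : Set M} (hS : Submodule.span R S = ⊤)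
    (J : Submodule R N) (h : ∀ z : ι → M, (∀ i, z i ∈ S) → g z ∈ J) (z : ι → M) : g z ∈ J := by
  classical
  have := Fintype.ofFinite ι
  -- The arguments are freed one at a time: `t` holds the positions no longer required to lie in
  -- `S`.
  have key : ∀ (t : Finset ι) (z : ι → M), (∀ i, i ∉ t → z i ∈ S) → g z ∈ J := by
    intro t
    induction t using Finset.induction_on with
    | empty => exact fun z hz => h z fun i => hz i (Finset.notMem_empty i)
    | insert j t hj ih =>
      intro z hz
      have hupd : ∀ x, g (Function.update z j x) ∈ J := by
        intro x
        have hx : x ∈ Submodule.span R S := hS ▸ trivial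
        induction hx using Submodule.span_induction with
        | mem x hx =>
          refine ih _ fun i hi => ?_
          by_cases hij : i = j
          · subst hij; rwa [Function.update_self]
          · rw [Function.update_of_ne hij]
            exact hz i (by simp [hij, hi])
        | zero => rw [g.map_update_zero]; exact zero_mem _
        | add x y _ _ hx hy => rw [g.map_update_add]; exact add_mem hx hy
        | smul c x _ hx => rw [g.map_update_smul]; exact J.smul_mem c hx
      simpa using hupd (z j)
  exact key Finset.univ z fun i hi => absurd (Finset.mem_univ i) hi

section PairDisc

variable {A : Type*} [Ring A] {v : ℕ}

/-- The determinant as an alternating function of the rows, over the centre. -/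
noncomputable def detAlternating (A : Type*) [Ring A] (v : ℕ) :
    (Fin v → CenterFrac A) [⋀^Fin v]→ₗ[Subring.center A] CenterFrac A :=
  { MultilinearMap.restrictScalars (Subring.center A)
      (Matrix.detRowAlternating (n := Fin v) (R := CenterFrac A)).toMultilinearMap with
    map_eq_zero_of_eq' := fun M _ _ h hij =>
      AlternatingMap.map_eq_zero_of_eq (Matrix.detRowAlternating (R := CenterFrac A)) M h hij }

/-- The row of traces `tr(x z'_j)` as a linear function of `x`. -/
noncomputable def traceRow (z' : Fin v → A) : A →ₗ[Subring.center A] (Fin v → CenterFrac A) :=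
  LinearMap.pi fun j => regTraceLinear ∘ₗ LinearMap.mulRight (Subring.center A) (z' j)

/-- The discriminant of a pair as an alternating map in its first argument. -/
noncomputable def pairDiscAlternating (z' : Fin v → A) :
    A [⋀^Fin v]→ₗ[Subring.center A] CenterFrac A :=
  (detAlternating A v).compLinearMap (traceRow z')

theorem pairDiscAlternating_apply (z z' : Fin v → A) :
    pairDiscAlternating z' z = pairDisc z z' := rfl

/-- The column of traces `tr(z_i x)` as a linear function of `x`. -/
noncomputable def traceCol (z : Fin v → A) : A →ₗ[Subring.center A] (Fin v → CenterFrac A) :=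
  LinearMap.pi fun i => regTraceLinear ∘ₗ LinearMap.mulLeft (Subring.center A) (z i)

theorem det_traceCol (z z' : Fin v → A) :
    (detAlternating A v).compLinearMap (traceCol z) z' = pairDisc z z' := by
  rw [pairDisc, ← Matrix.det_transpose]
  rfl

theorem pairDisc_eq_zero_of_not_linearIndependent [IsDomain A] {z : Fin v → A}
    (hz : ¬ LinearIndependent (Subring.center A) z) (z' : Fin v → A) : pairDisc z z' = 0 := by
  rw [← pairDiscAlternating_apply]
  exact AlternatingMap.map_linearDependent _ _ hz

theorem pairDisc_mem_of_span_eq_top {S : Set A}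
    (hS : Submodule.span (Subring.center A) S = ⊤)
    (J : Submodule (Subring.center A) (CenterFrac A))
    (h : ∀ z z' : Fin v → A, (∀ i, z i ∈ S) → (∀ i, z' i ∈ S) → pairDisc z z' ∈ J)
    (z z' : Fin v → A) : pairDisc z z' ∈ J := by
  rw [← det_traceCol]
  refine MultilinearMap.mem_of_forall_mem_of_span_eq_top (AlternatingMap.toMultilinearMap _) hS J
    (fun z' hz' => ?_) z'
  change (detAlternating A v).compLinearMap (traceCol z) z' ∈ J
  rw [det_traceCol, ← pairDiscAlternating_apply]
  refine MultilinearMap.mem_of_forall_mem_of_span_eq_top (AlternatingMap.toMultilinearMap _) hS J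
    (fun z hz => ?_) z
  exact h z z' hz hz'

theorem pairDisc_comp_perm (z z' : Fin v → A) (σ : Equiv.Perm (Fin v)) :
    pairDisc z (z' ∘ σ) = (Equiv.Perm.sign σ : ℤ) * pairDisc z z' := by
  rw [pairDisc, pairDisc]
  exact Matrix.det_permute' σ (Matrix.of fun i j => regTrace (z i * z' j))

theorem not_linearIndependent_center_of_centerRank_lt [IsDomain A]
    [Module.Finite (CenterFrac A) (CenterLoc A)] (hv : centerRank A < v) (z : Fin v → A) :
    ¬ LinearIndependent (Subring.center A) z := by
  intro hli
  have := (LinearIndependent.of_isLocalizedModule (CenterFrac A)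
    (nonZeroDivisors (Subring.center A))
    (TensorProduct.mk (Subring.center A) (CenterFrac A) A 1) hli).fintype_card_le_finrank
  rw [Fintype.card_fin] at this
  exact absurd hv (not_lt.mpr this)

/-- The elements of `A` of which a `v`-discriminant is a greatest common divisor. -/
def discSet (A : Type*) [Ring A] (v : ℕ) : Set A :=
  {r : A | ∃ (z z' : Fin v → A) (c : Subring.center A),
    (c : A) = r ∧ algebraMap _ (CenterFrac A) c = pairDisc z z'}

end PairDisc

/-! ### Exponents of monomial discriminants -/

/-- The exponents of the monomials that occur as discriminants of pairs of `v`-tuples of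
monomials. -/
def discExponents {k : Type*} [CommRing k] {n : ℕ} (p : Fin n → Fin n → kˣ) (v : ℕ) :
    Set (Fin n → ℕ) :=
  {e | ∃ a b : Fin v → Fin n → ℕ, (Function.Injective fun i => commFactor p (a i)) ∧
    (∀ i, commFactor p (a i + b i) = 1) ∧ ∑ i, (a i + b i) = e}

/-- The componentwise minimum of `discExponents`. -/
noncomputable def minExponent {k : Type*} [CommRing k] {n : ℕ} (p : Fin n → Fin n → kˣ) (v : ℕ) :
    Fin n → ℕ :=
  fun s => sInf ((fun e : Fin n → ℕ => e s) '' discExponents p v)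

section DiscExponents

variable {k : Type*} [CommRing k] {n : ℕ} {p : Fin n → Fin n → kˣ} {v : ℕ}

theorem minExponent_le {e : Fin n → ℕ} (he : e ∈ discExponents p v) : minExponent p v ≤ e :=
  fun _ => Nat.sInf_le ⟨e, he, rfl⟩

theorem exists_mem_discExponents_eq (h : (discExponents p v).Nonempty) (s : Fin n) :
    ∃ e ∈ discExponents p v, e s = minExponent p v s :=
  Nat.sInf_mem (h.image fun e : Fin n → ℕ => e s)

theorem discExponents_nonempty (hfin : ∀ i j, IsOfFinOrder (p i j))
    (hv : v ≤ Nat.card (Set.range (commFactor p))) : (discExponents p v).Nonempty := by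
  have := (finite_range_commFactor hfin).to_subtype
  have := Fintype.ofFinite (Set.range (commFactor p))
  obtain ⟨f⟩ : Nonempty (Fin v ↪ Set.range (commFactor p)) := by
    rw [Function.Embedding.nonempty_iff_card_le, Fintype.card_fin, ← Nat.card_eq_fintype_card]
    exact hv
  choose b hb using fun i => exists_commFactor_add_eq_one hfin (MonomialBasis.rep (f i))
  refine ⟨_, fun i => MonomialBasis.rep (f i), b, fun i j h => ?_, fun i => ?_, rfl⟩
  · simp only [MonomialBasis.commFactor_rep] at h
    exact f.injective (Subtype.ext h)
  · rw [add_comm, hb]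

end DiscExponents

/-! ### The greatest common divisor of the discriminants -/

namespace MonomialBasis

variable {k : Type*} [CommRing k] {n : ℕ} {p : Fin n → Fin n → kˣ} {A : Type*} [Ring A]
  [Algebra k A] (B : MonomialBasis p A) {v : ℕ}

theorem exists_coe_prod_eq_smul_basis {ι : Type*} (s : Finset ι) {z : ι → Subring.center A}
    {c : ι → k} {e : ι → Fin n → ℕ} (h : ∀ i, (z i : A) = c i • B.basis (e i)) :
    ∃ u : kˣ, ((∏ i ∈ s, z i : Subring.center A) : A) =
      ((∏ i ∈ s, c i) * u) • B.basis (∑ i ∈ s, e i) := by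
  classical
  induction s using Finset.induction_on with
  | empty => exact ⟨1, by simp [B.basis_zero]⟩
  | insert j s hj ih =>
    obtain ⟨u, hu⟩ := ih
    refine ⟨u * B.cocycle (e j) (∑ i ∈ s, e i), ?_⟩
    rw [Finset.prod_insert hj, Finset.prod_insert hj, Finset.sum_insert hj, Subring.coe_mul, hu, h,
      smul_mul_smul_comm, B.basis_mul, smul_smul, Units.val_mul]
    congr 1
    ring

variable [IsDomain k]

omit [IsDomain k] in
theorem regTrace_smul (c : k) (a : A) :
    regTrace (c • a) = algebraMap _ (CenterFrac A)
      (⟨c • (1 : A), smul_mem_center c (one_mem _)⟩ : Subring.center A) * regTrace a := by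
  have : c • a = (⟨c • (1 : A), smul_mem_center c (one_mem _)⟩ : Subring.center A) • a := by
    rw [center_smul_def, smul_mul_assoc, one_mul]
  rw [this, ← regTraceLinear_apply, map_smul, Algebra.smul_def, regTraceLinear_apply]

theorem regTrace_basis_mul_basis_eq_zero (hfin : ∀ i j, IsOfFinOrder (p i j))
    {a b : Fin n → ℕ} (h : commFactor p (a + b) ≠ 1) :
    regTrace (B.basis a * B.basis b) = 0 := by
  rw [B.basis_mul, regTrace_smul, B.regTrace_basis_of_commFactor_ne_one hfin h, mul_zero]

theorem exists_regTrace_basis_mul_basis (hfin : ∀ i j, IsOfFinOrder (p i j))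
    {a b : Fin n → ℕ} (h : commFactor p (a + b) = 1) :
    ∃ z : Subring.center A,
      (z : A) = ((centerRank A : k) * B.cocycle a b) • B.basis (a + b) ∧
      regTrace (B.basis a * B.basis b) = algebraMap _ (CenterFrac A) z := by
  refine ⟨⟨((centerRank A : k) * B.cocycle a b) • B.basis (a + b),
    smul_mem_center _ (B.basis_mem_center h)⟩, rfl, ?_⟩
  rw [B.basis_mul, regTrace_smul, B.regTrace_basis_of_commFactor_eq_one hfin h, ← map_mul]
  congr 1
  refine Subtype.ext ?_
  rw [Subring.coe_mul, smul_mul_smul_comm, one_mul, mul_comm (B.cocycle a b : k)]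

theorem exists_pairDisc_basis (hfin : ∀ i j, IsOfFinOrder (p i j)) {a b : Fin v → Fin n → ℕ}
    (ha : Function.Injective fun i => commFactor p (a i))
    (hab : ∀ i, commFactor p (a i + b i) = 1) :
    ∃ (u : kˣ) (z : Subring.center A),
      (z : A) = ((centerRank A : k) ^ v * u) • B.basis (∑ i, (a i + b i)) ∧
      algebraMap _ (CenterFrac A) z =
        pairDisc (fun i => B.basis (a i)) (fun i => B.basis (b i)) := by
  choose z hz hz' using fun i => B.exists_regTrace_basis_mul_basis hfin (hab i)
  have hdiag : (Matrix.of fun i j => regTrace (B.basis (a i) * B.basis (b j))) =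
      Matrix.diagonal fun i => algebraMap _ (CenterFrac A) (z i) := by
    ext i j
    rw [Matrix.of_apply]
    by_cases hij : i = j
    · subst hij
      rw [hz', Matrix.diagonal_apply_eq]
    · rw [Matrix.diagonal_apply_ne _ hij]
      -- The class of `b j` is inverse to that of `a j`, so a nonzero entry (i, j) would put `a i`
      -- and `a j` in one class.
      refine B.regTrace_basis_mul_basis_eq_zero hfin fun h => hij (ha ?_)
      rw [← hab j, commFactor_add, commFactor_add] at h
      exact mul_right_cancel h
  obtain ⟨u, hu⟩ := B.exists_coe_prod_eq_smul_basis Finset.univ hz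
  refine ⟨(∏ i, B.cocycle (a i) (b i)) * u, ∏ i, z i, ?_, ?_⟩
  · rw [hu, Finset.prod_mul_distrib, Finset.prod_const, Finset.card_univ, Fintype.card_fin,
      Units.val_mul, Units.coe_prod, mul_assoc]
  · rw [pairDisc, hdiag, Matrix.det_diagonal, map_prod]

/-- A nonzero determinant requires distinct row classes, by linear independence, and a nonzero term
in its permutation expansion. Reordering the columns by that permutation, at the cost of a sign,
gives the diagonal case. -/
theorem pairDisc_basis_eq_zero_or (hfin : ∀ i j, IsOfFinOrder (p i j))
    (a b : Fin v → Fin n → ℕ) :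
    pairDisc (fun i => B.basis (a i)) (fun i => B.basis (b i)) = 0 ∨
    ∃ e ∈ discExponents p v, ∃ (c : k) (z : Subring.center A),
      (z : A) = ((centerRank A : k) ^ v * c) • B.basis e ∧
      algebraMap _ (CenterFrac A) z =
        pairDisc (fun i => B.basis (a i)) (fun i => B.basis (b i)) := by
  have := B.isDomain
  refine or_iff_not_imp_left.mpr fun h => ?_
  have ha : Function.Injective fun i => commFactor p (a i) := by
    intro i j hij
    by_contra hne
    exact h (pairDisc_eq_zero_of_not_linearIndependent
      (B.not_linearIndependent_of_commFactor_eq hfin hne hij) _)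
  have hσ : ∃ σ : Equiv.Perm (Fin v), ∀ i, commFactor p (a (σ i) + b i) = 1 := by
    rw [pairDisc, Matrix.det_apply'] at h
    obtain ⟨σ, -, hσ⟩ := Finset.exists_ne_zero_of_sum_ne_zero h
    refine ⟨σ, fun i => ?_⟩
    by_contra hi
    refine hσ ?_
    rw [Finset.prod_eq_zero (Finset.mem_univ i), mul_zero]
    exact B.regTrace_basis_mul_basis_eq_zero hfin hi
  obtain ⟨σ, hσ⟩ := hσ
  have hσ' : ∀ i, commFactor p (a i + (b ∘ σ.symm) i) = 1 := fun i => by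
    simpa using hσ (σ.symm i)
  obtain ⟨u, z, hz, hz'⟩ := B.exists_pairDisc_basis hfin ha hσ'
  have hsign := pairDisc_comp_perm (fun i => B.basis (a i)) (fun i => B.basis (b i)) σ.symm
  refine ⟨_, ⟨a, _, ha, hσ', rfl⟩, ((Equiv.Perm.sign σ.symm : ℤ) : k) * u,
    ((Equiv.Perm.sign σ.symm : ℤ) : Subring.center A) * z, ?_, ?_⟩
  · rw [Subring.coe_mul, hz, Subring.coe_intCast, ← zsmul_eq_mul, ← Int.cast_smul_eq_zsmul k,
      smul_smul]
    congr 1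
    ring
  · rw [map_mul, hz', map_intCast]
    have hcomp : (fun i => B.basis ((b ∘ σ.symm) i)) = (fun i => B.basis (b i)) ∘ σ.symm := rfl
    rw [hcomp, hsign, ← mul_assoc, ← Int.cast_mul, Int.units_coe_mul_self, Int.cast_one, one_mul]

/-- The greatest common divisor of the discriminants of pairs of `v`-tuples. -/
noncomputable def disc (v : ℕ) : A := ((centerRank A : k) ^ v) • B.basis (minExponent p v)

theorem nDvd_disc_of_mem_discSet (hfin : ∀ i j, IsOfFinOrder (p i j)) {r : A}
    (hr : r ∈ discSet A v) : NDvd (B.disc v) r := by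
  have := B.isDomain
  -- The central multiples of `disc` form an ideal of the centre; its image in F is a submodule, so
  -- multilinearity reduces membership to monomial tuples.
  let I : Submodule (Subring.center A) (Subring.center A) :=
    { carrier := {c | NDvd (B.disc v) (c : A)}
      zero_mem' := ⟨0, by simp⟩
      add_mem' := by
        rintro c c' ⟨f, hf⟩ ⟨f', hf'⟩
        exact ⟨f + f', by rw [Subring.coe_add, hf, hf', add_mul]⟩
      smul_mem' := by
        rintro c c' ⟨f, hf⟩
        exact ⟨c * f, by rw [smul_eq_mul, Subring.coe_mul, hf, mul_assoc]⟩ }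
  obtain ⟨z, z', c, rfl, hc⟩ := hr
  have hmem : pairDisc z z' ∈ I.map (Algebra.linearMap _ (CenterFrac A)) := by
    refine pairDisc_mem_of_span_eq_top B.span_center_range_basis _ (fun z z' hz hz' => ?_) z z'
    choose a ha using hz
    choose b hb using hz'
    obtain rfl : (fun i => B.basis (a i)) = z := funext ha
    obtain rfl : (fun i => B.basis (b i)) = z' := funext hb
    rcases B.pairDisc_basis_eq_zero_or hfin a b with h | ⟨e, he, u, z, hz, hz'⟩
    · rw [h]; exact zero_mem _
    · refine ⟨z, ?_, hz'⟩
      change NDvd (B.disc v) (z : A)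
      rw [hz, disc]
      by_cases hu : u = 0
      · subst hu
        exact ⟨0, by simp⟩
      · rw [B.nDvd_smul_basis_iff
          (mul_ne_zero (pow_ne_zero _ (B.centerRank_ne_zero hfin)) hu)]
        exact ⟨dvd_mul_right _ _, minExponent_le he⟩
  obtain ⟨c', hc', hcc⟩ := hmem
  rw [← hc, Algebra.linearMap_apply] at hcc
  rw [← IsFractionRing.injective (Subring.center A) (CenterFrac A) hcc]
  exact hc'

theorem exists_unit_smul_mem_discSet (hfin : ∀ i j, IsOfFinOrder (p i j)) {e : Fin n → ℕ}
    (he : e ∈ discExponents p v) :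
    ∃ u : kˣ, ((centerRank A : k) ^ v * u) • B.basis e ∈ discSet A v := by
  obtain ⟨a, b, ha, hab, rfl⟩ := he
  obtain ⟨u, z, hz, hz'⟩ := B.exists_pairDisc_basis hfin ha hab
  exact ⟨u, _, _, z, hz, hz'⟩

theorem isNormalGCD_disc (hfin : ∀ i j, IsOfFinOrder (p i j))
    (hne : (discExponents p v).Nonempty) : IsNormalGCD (discSet A v) (B.disc v) where
  normal := B.isNormalElt_smul_basis _ _
  dvd _ hr := B.nDvd_disc_of_mem_discSet hfin hr
  greatest y _ hy := by
    -- Since w is nonzero in k, the monomial discriminants are nonzero; dividing one of them forces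
    -- `y` to be a monomial.
    have hw : ∀ u : kˣ, (centerRank A : k) ^ v * u ≠ 0 := fun u =>
      mul_ne_zero (pow_ne_zero _ (B.centerRank_ne_zero hfin)) u.ne_zero
    have hex : ∃ (c : k) (a : Fin n → ℕ), y = c • B.basis a := by
      obtain ⟨e, he⟩ := hne
      obtain ⟨u, hu⟩ := B.exists_unit_smul_mem_discSet hfin he
      exact B.exists_eq_smul_basis_of_nDvd (hw u) (hy _ hu)
    obtain ⟨c, a, rfl⟩ := hex
    have hdvd : ∀ e ∈ discExponents p v, c ∣ (centerRank A : k) ^ v ∧ a ≤ e := by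
      intro e he
      obtain ⟨u, hu⟩ := B.exists_unit_smul_mem_discSet hfin he
      have := (B.nDvd_smul_basis_iff (hw u)).mp (hy _ hu)
      rwa [Units.dvd_mul_right] at this
    rw [disc, B.nDvd_smul_basis_iff (by simpa using hw 1)]
    -- The minimum need not be attained by a single discriminant, but each coordinate of it is,
    -- which suffices for a comparison of exponents.
    refine ⟨(hdvd _ hne.some_mem).1, fun s => ?_⟩
    obtain ⟨e, he, hes⟩ := exists_mem_discExponents_eq hne s
    rw [← hes]
    exact (hdvd e he).2 s

/-- Any gcd and `disc` divide each other, so they are monomials with the same exponent. -/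
theorem eq_smul_basis_of_isNormalGCD (hfin : ∀ i j, IsOfFinOrder (p i j))
    (hne : (discExponents p v).Nonempty) {d : A} (hd : IsNormalGCD (discSet A v) d) :
    ∃ c : k, c ≠ 0 ∧ d = c • B.basis (minExponent p v) := by
  have := B.isDomain
  have hw : (centerRank A : k) ^ v ≠ 0 := pow_ne_zero _ (B.centerRank_ne_zero hfin)
  have hdisc := B.isNormalGCD_disc hfin hne
  have h1 : NDvd d (B.disc v) := hdisc.greatest d hd.normal hd.dvd
  have h2 : NDvd (B.disc v) d := hd.greatest _ hdisc.normal hdisc.dvd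
  obtain ⟨c, a, rfl⟩ := B.exists_eq_smul_basis_of_nDvd hw h1
  have hc : c ≠ 0 := by
    rintro rfl
    exact hw (zero_dvd_iff.mp ((B.nDvd_smul_basis_iff hw).mp h1).1)
  rw [le_antisymm ((B.nDvd_smul_basis_iff hw).mp h1).2 ((B.nDvd_smul_basis_iff hc).mp h2).2]
  exact ⟨c, hc, rfl⟩

include B in
theorem discSet_eq_of_centerRank_lt (hfin : ∀ i j, IsOfFinOrder (p i j))
    (hv : centerRank A < v) : discSet A v = {0} := by
  have := B.isDomain
  have := B.finite_centerLoc hfin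
  have hzero : ∀ z z' : Fin v → A, pairDisc z z' = 0 := fun z z' =>
    pairDisc_eq_zero_of_not_linearIndependent
      (not_linearIndependent_center_of_centerRank_lt hv z) z'
  refine Set.eq_singleton_iff_unique_mem.mpr ⟨⟨0, 0, 0, rfl, by rw [hzero, map_zero]⟩, ?_⟩
  rintro _ ⟨z, z', c, rfl, hc⟩
  rw [hzero, ← map_zero (algebraMap (Subring.center A) (CenterFrac A))] at hc
  rw [IsFractionRing.injective (Subring.center A) (CenterFrac A) hc, Subring.coe_zero]

include B in
theorem isVDiscriminant_iff (hfin : ∀ i j, IsOfFinOrder (p i j)) (d : A) :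
    IsVDiscriminant v d ↔ IsNormalGCD (discSet A v) d :=
  ⟨fun h => h.isGCD, fun h => ⟨B.finite_centerLoc hfin, B.free_centerLoc hfin,
    B.exists_algebraMap_eq_regTrace hfin, h⟩⟩

include B in
theorem discExponents_nonempty_of_le (hfin : ∀ i j, IsOfFinOrder (p i j))
    (hv : v ≤ centerRank A) : (discExponents p v).Nonempty :=
  discExponents_nonempty hfin (B.centerRank_eq hfin ▸ hv)

end MonomialBasis

/-- Zero is itself a normal common divisor of `{0}`, so it divides every gcd, and its only multiple
is zero. -/
theorem isNormalGCD_singleton_zero {A : Type*} [Ring A] (d : A) :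
    IsNormalGCD {(0 : A)} d ↔ d = 0 := by
  constructor
  · intro h
    obtain ⟨f, hf⟩ := h.greatest 0 ⟨fun _ => ⟨0, by simp⟩, fun _ => ⟨0, by simp⟩⟩
      fun r hr => ⟨0, by simpa using hr⟩
    rw [hf, mul_zero]
  · rintro rfl
    exact ⟨⟨fun _ => ⟨0, by simp⟩, fun _ => ⟨0, by simp⟩⟩, fun r hr => ⟨0, by simpa using hr⟩,
      fun y _ _ => ⟨0, by simp⟩⟩

/-! ### The sets T_s and the vanishing of minimal exponents -/

/-- The product is ∏ p_{ij}^{a_i a_j}, where the factors of (i, j) and (j, i) cancel. It supplies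
the equation for i = s that is absent from the definition of T_s. -/
theorem prod_commFactor_pow_self {k : Type*} [CommRing k] {n : ℕ} {p : Fin n → Fin n → kˣ}
    (hdiag : ∀ i, p i i = 1) (hskew : ∀ i j, p j i = (p i j)⁻¹) (a : Fin n → ℕ) :
    ∏ i, commFactor p a i ^ a i = 1 := by
  induction a using exponent_induction with
  | zero => simp
  | add_single a i ih =>
    have h1 : ∀ l, commFactor p (a + Pi.single i 1) l ^ (a + Pi.single i 1 : Fin n → ℕ) l =
        commFactor p a l ^ a l * p l i ^ a l * if l = i then commFactor p a i else 1 := by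
      intro l
      by_cases hl : l = i
      · subst hl
        simp [commFactor_add, commFactor_single, hdiag, pow_succ]
      · simp [commFactor_add, commFactor_single, hl, mul_pow]
    rw [Finset.prod_congr rfl fun l _ => h1 l, Finset.prod_mul_distrib, Finset.prod_mul_distrib,
      ih, one_mul, Finset.prod_ite_eq' Finset.univ i, if_pos (Finset.mem_univ i), commFactor,
      ← Finset.prod_mul_distrib]
    refine Finset.prod_eq_one fun l _ => ?_
    rw [← mul_pow, hskew i l, inv_mul_cancel, one_pow]

theorem SkewPoly.T_ne_empty_iff {k : Type*} [CommRing k] {n : ℕ} {p : Fin n → Fin n → kˣ}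
    (hdiag : ∀ i, p i i = 1) (hskew : ∀ i j, p j i = (p i j)⁻¹) (s : Fin n) :
    SkewPoly.T p s ≠ ∅ ↔
      ∃ a : Fin n → ℕ, a s = 0 ∧ commFactor p a = commFactor p (Pi.single s 1) := by
  rw [← Set.nonempty_iff_ne_empty]
  have hsplit : ∀ (a : Fin n → ℕ) (i : Fin n), a s = 0 →
      commFactor p a i = ∏ j : {j : Fin n // j ≠ s}, p i j ^ a j := by
    intro a i ha
    rw [commFactor, ← Fintype.prod_subtype_mul_prod_subtype (fun j => j ≠ s),
      Fintype.prod_eq_one (fun j : {j : Fin n // ¬ j ≠ s} => p i j ^ a j), mul_one]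
    rintro ⟨j, hj⟩
    obtain rfl := not_not.mp hj
    exact (congrArg (p i j ^ ·) ha).trans (pow_zero _)
  constructor
  · rintro ⟨d, hd⟩
    let a : Fin n → ℕ := fun j => if h : j ≠ s then d ⟨j, h⟩ else 0
    have has : a s = 0 := by simp [a]
    have hne : ∀ i, i ≠ s → commFactor p a i = p i s := by
      intro i hi
      rw [hsplit a i has, ← hd i hi]
      refine Finset.prod_congr rfl fun j _ => ?_
      have : a j = d j := dif_pos j.2
      rw [this]
    refine ⟨a, has, funext fun i => ?_⟩
    rw [commFactor_single]
    by_cases hi : i = s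
    · subst hi
      -- The inverse of the s-th factor is ∏ p_{js}^{a_j}. For j ≠ s the known equations identify
      -- p_{js} with `commFactor p a j`, and the j = s term is trivial because a_s = 0, so this is
      -- the product just shown to be 1.
      rw [hdiag, commFactor, ← inv_eq_one, ← Finset.prod_inv_distrib,
        ← prod_commFactor_pow_self hdiag hskew a]
      refine Finset.prod_congr rfl fun j _ => ?_
      by_cases hj : j = i
      · subst hj; rw [has, pow_zero, pow_zero, inv_one]
      · rw [hne j hj, hskew i j, inv_pow]
    · exact hne i hi
  · rintro ⟨a, has, ha⟩
    refine ⟨fun j => a j, fun i _ => ?_⟩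
    rw [← hsplit a i has, ha, commFactor_single]

/-- The minimal exponent of `x_s` among the full discriminants vanishes exactly when every class of
monomials has a representative not involving `x_s`. -/
theorem minExponent_eq_zero_iff {k : Type*} [CommRing k] {n : ℕ} {p : Fin n → Fin n → kˣ}
    (hdiag : ∀ i, p i i = 1) (hskew : ∀ i j, p j i = (p i j)⁻¹)
    (hfin : ∀ i j, IsOfFinOrder (p i j)) (s : Fin n) :
    minExponent p (Nat.card (Set.range (commFactor p))) s = 0 ↔ SkewPoly.T p s ≠ ∅ := by
  have hfinite := (finite_range_commFactor hfin).to_subtype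
  rw [SkewPoly.T_ne_empty_iff hdiag hskew]
  have hne := discExponents_nonempty (v := Nat.card (Set.range (commFactor p))) hfin le_rfl
  constructor
  · intro h0
    obtain ⟨e, ⟨a, b, ha, hab, rfl⟩, he⟩ := exists_mem_discExponents_eq hne s
    rw [h0, Finset.sum_apply, Finset.sum_eq_zero_iff] at he
    have hinj : Function.Injective fun i =>
        (⟨commFactor p (a i), a i, rfl⟩ : Set.range (commFactor p)) := fun i j h =>
      ha (congrArg Subtype.val h)
    -- By counting, the |G| distinct classes of the `a i` are all of G, so one is the class of x_s;
    -- a vanishing sum of naturals makes its s-th exponent zero.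
    obtain ⟨i, hi⟩ := (hinj.bijective_of_nat_card_le (Nat.card_fin _).ge).surjective
      ⟨_, Pi.single s 1, rfl⟩
    exact ⟨a i, (Nat.add_eq_zero_iff.mp (he i (Finset.mem_univ i))).1, congrArg Subtype.val hi⟩
  · rintro ⟨t, hts, ht⟩
    have hnorm : ∀ a, ∃ a', a' s = 0 ∧ commFactor p a' = commFactor p a := by
      intro a
      -- Each factor x_s is replaced by x^t, which has the same class and does not involve x_s.
      refine ⟨Function.update a s 0 + a s • t, by simp [hts], ?_⟩
      have : a = Function.update a s 0 + a s • Pi.single s 1 := by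
        funext j
        by_cases hj : j = s
        · subst hj; simp
        · simp [hj]
      conv_rhs => rw [this]
      rw [commFactor_add, commFactor_add, commFactor_nsmul, commFactor_nsmul, ht]
    choose norm hnorm_s hnorm using hnorm
    choose inv hinv using fun a => exists_commFactor_add_eq_one (p := p) hfin a
    let f := (Finite.equivFin (Set.range (commFactor p))).symm
    have hmem : ∑ i, (norm (MonomialBasis.rep (f i)) + norm (inv (MonomialBasis.rep (f i)))) ∈
        discExponents p (Nat.card (Set.range (commFactor p))) := by
      refine ⟨_, _, fun i j h => ?_, fun i => ?_, rfl⟩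
      · simp only [hnorm, MonomialBasis.commFactor_rep] at h
        exact f.injective (Subtype.ext h)
      · rw [commFactor_add, hnorm, hnorm, mul_comm, ← commFactor_add, hinv]
    have := minExponent_le hmem s
    simpa [hnorm_s] using this

/-! ### Degrees when the associated graded ring is a domain -/

namespace AlgFiltration

variable {k T : Type*} [CommRing k] [Ring T] [Algebra k T] (𝓕 : AlgFiltration k T)

theorem mem_F_deg (a : T) : a ∈ 𝓕.F (𝓕.deg a) := Nat.sInf_mem (𝓕.exhaustive a)

theorem deg_le {a : T} {i : ℕ} (h : a ∈ 𝓕.F i) : 𝓕.deg a ≤ i := Nat.sInf_le h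

theorem notMem_Fpred_deg {a : T} (ha : a ≠ 0) : a ∉ 𝓕.Fpred (𝓕.deg a) := by
  intro h
  rcases hd : 𝓕.deg a with _ | i
  · rw [hd] at h
    exact ha h
  · rw [hd] at h
    exact absurd (𝓕.deg_le h) (by omega)

theorem F_le_Fpred {i j : ℕ} (h : i < j) : 𝓕.F i ≤ 𝓕.Fpred j := by
  cases j with
  | zero => omega
  | succ j => exact 𝓕.mono (Nat.lt_succ_iff.mp h)

theorem deg_eq_of_notMem_Fpred {a : T} {i : ℕ} (h : a ∈ 𝓕.F i) (h' : a ∉ 𝓕.Fpred i) :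
    𝓕.deg a = i := by
  refine le_antisymm (𝓕.deg_le h) ?_
  by_contra! hlt
  exact h' (𝓕.F_le_Fpred hlt (𝓕.mem_F_deg a))

theorem gr_mk_eq_zero_iff (f : 𝓕.rees) :
    (𝓕.reesIdeal.ringCon.mk' f) = 0 ↔ ∀ i, (f : Polynomial T).coeff i ∈ 𝓕.Fpred i := by
  rw [← mem_reesIdeal, TwoSidedIdeal.mem_iff, ← map_zero 𝓕.reesIdeal.ringCon.mk']
  exact RingCon.eq _

/-- The homogeneous element `a t^i` of the Rees ring. -/
noncomputable def reesMonomial {i : ℕ} {a : T} (h : a ∈ 𝓕.F i) : 𝓕.rees :=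
  ⟨Polynomial.monomial i a, fun j => by
    rw [Polynomial.coeff_monomial]
    split_ifs with hij
    · exact hij ▸ h
    · exact zero_mem _⟩

theorem gr_mk_reesMonomial_eq_zero_iff {i : ℕ} {a : T} (h : a ∈ 𝓕.F i) :
    𝓕.reesIdeal.ringCon.mk' (𝓕.reesMonomial h) = 0 ↔ a ∈ 𝓕.Fpred i := by
  rw [gr_mk_eq_zero_iff]
  constructor
  · intro h'
    simpa [reesMonomial] using h' i
  · intro h' j
    simp only [reesMonomial, Polynomial.coeff_monomial]
    split_ifs with hij
    · exact hij ▸ h'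
    · exact zero_mem _

theorem mul_notMem_Fpred [IsDomain 𝓕.gr] {i j : ℕ} {a b : T} (ha : a ∈ 𝓕.F i)
    (ha' : a ∉ 𝓕.Fpred i) (hb : b ∈ 𝓕.F j) (hb' : b ∉ 𝓕.Fpred j) : a * b ∉ 𝓕.Fpred (i + j) := by
  rw [← 𝓕.gr_mk_reesMonomial_eq_zero_iff ha] at ha'
  rw [← 𝓕.gr_mk_reesMonomial_eq_zero_iff hb] at hb'
  rw [← 𝓕.gr_mk_reesMonomial_eq_zero_iff (𝓕.mul_mem ha hb)]
  have : 𝓕.reesMonomial (𝓕.mul_mem ha hb) = 𝓕.reesMonomial ha * 𝓕.reesMonomial hb :=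
    Subtype.ext (Polynomial.monomial_mul_monomial i j a b).symm
  rw [this, map_mul]
  exact mul_ne_zero ha' hb'

theorem isDomain_gr [Nontrivial T]
    (h : ∀ {i j : ℕ} {a b : T}, a ∈ 𝓕.F i → a ∉ 𝓕.Fpred i → b ∈ 𝓕.F j → b ∉ 𝓕.Fpred j →
      a * b ∉ 𝓕.Fpred (i + j)) : IsDomain 𝓕.gr := by
  have hnt : Nontrivial 𝓕.gr := by
    refine ⟨⟨1, 0, fun h10 => ?_⟩⟩
    have := (𝓕.gr_mk_eq_zero_iff 1).mp ((map_one _).trans h10) 0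
    rw [Subring.coe_one, Polynomial.coeff_one_zero] at this
    exact one_ne_zero this
  -- A nonzero class in gr has a highest index with nonzero component; the product of two such top
  -- components cannot cancel.
  have htop : ∀ f : 𝓕.rees, 𝓕.reesIdeal.ringCon.mk' f ≠ 0 → ∃ i,
      (f : Polynomial T).coeff i ∉ 𝓕.Fpred i ∧
      ∀ j, i < j → (f : Polynomial T).coeff j ∈ 𝓕.Fpred j := by
    intro f hf
    rw [Ne, gr_mk_eq_zero_iff, not_forall] at hf
    have hbdd : ∀ i, (f : Polynomial T).coeff i ∉ 𝓕.Fpred i →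
        i ≤ (f : Polynomial T).natDegree := by
      intro i hi
      refine Polynomial.le_natDegree_of_ne_zero fun h0 => hi ?_
      rw [h0]
      exact zero_mem _
    classical
    obtain ⟨i₀, hi₀⟩ := hf
    refine ⟨Nat.findGreatest (fun i => (f : Polynomial T).coeff i ∉ 𝓕.Fpred i)
      (f : Polynomial T).natDegree,
      Nat.findGreatest_spec (P := fun i => (f : Polynomial T).coeff i ∉ 𝓕.Fpred i)
        (hbdd _ hi₀) hi₀, fun j hj => ?_⟩
    by_contra hj'
    exact Nat.findGreatest_is_greatest hj (hbdd j hj') hj'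
  have : NoZeroDivisors 𝓕.gr := ⟨by
    intro x y hxy
    obtain ⟨f, rfl⟩ := RingCon.mk'_surjective _ x
    obtain ⟨g, rfl⟩ := RingCon.mk'_surjective _ y
    by_contra! hne
    obtain ⟨i, hi, hi'⟩ := htop f hne.1
    obtain ⟨j, hj, hj'⟩ := htop g hne.2
    rw [← map_mul, gr_mk_eq_zero_iff] at hxy
    have hsum := hxy (i + j)
    rw [Subring.coe_mul, Polynomial.coeff_mul,
      ← Finset.add_sum_erase _ _ (Finset.HasAntidiagonal.mem_antidiagonal.mpr rfl :
        (i, j) ∈ Finset.HasAntidiagonal.antidiagonal (i + j))] at hsum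
    refine h (f.2 i) hi (g.2 j) hj
      ((Submodule.add_mem_iff_left _ (Submodule.sum_mem _ fun x hx => ?_)).mp hsum)
    rw [Finset.mem_erase, Finset.HasAntidiagonal.mem_antidiagonal] at hx
    rw [← hx.2]
    rcases lt_trichotomy i x.1 with hlt | heq | hlt
    · exact 𝓕.Fpred_mul (hi' _ hlt) (g.2 _)
    · exact absurd (Prod.ext heq.symm (by omega)) hx.1
    · exact 𝓕.mul_Fpred (f.2 _) (hj' _ (by omega))⟩
  exact NoZeroDivisors.to_isDomain _

section Degree

variable [IsDomain 𝓕.gr]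

theorem mul_ne_zero_and_deg_mul {a b : T} (ha : a ≠ 0) (hb : b ≠ 0) :
    a * b ≠ 0 ∧ 𝓕.deg (a * b) = 𝓕.deg a + 𝓕.deg b := by
  have h := 𝓕.mul_notMem_Fpred (𝓕.mem_F_deg a) (𝓕.notMem_Fpred_deg ha) (𝓕.mem_F_deg b)
    (𝓕.notMem_Fpred_deg hb)
  exact ⟨fun h0 => h (h0 ▸ zero_mem _),
    𝓕.deg_eq_of_notMem_Fpred (𝓕.mul_mem (𝓕.mem_F_deg a) (𝓕.mem_F_deg b)) h⟩

variable [Nontrivial T]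

theorem pow_ne_zero_and_deg_pow {a : T} (ha : a ≠ 0) (m : ℕ) :
    a ^ m ≠ 0 ∧ 𝓕.deg (a ^ m) = m * 𝓕.deg a := by
  induction m with
  | zero =>
    rw [pow_zero, zero_mul]
    exact ⟨one_ne_zero, Nat.le_zero.mp (𝓕.deg_le 𝓕.one_mem)⟩
  | succ m ih =>
    have := 𝓕.mul_ne_zero_and_deg_mul ih.1 ha
    rw [pow_succ, this.2, ih.2]
    exact ⟨this.1, by ring⟩

theorem prod_ne_zero_and_deg_prod (l : List T) (hl : ∀ a ∈ l, a ≠ 0) :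
    l.prod ≠ 0 ∧ 𝓕.deg l.prod = (l.map 𝓕.deg).sum := by
  induction l with
  | nil => exact ⟨one_ne_zero, Nat.le_zero.mp (𝓕.deg_le 𝓕.one_mem)⟩
  | cons a l ih =>
    have hl' := List.forall_mem_cons.mp hl
    have := 𝓕.mul_ne_zero_and_deg_mul hl'.1 (ih hl'.2).1
    rw [List.prod_cons, List.map_cons, List.sum_cons, this.2, (ih hl'.2).2]
    exact ⟨this.1, rfl⟩

theorem deg_smul_monomial {n : ℕ} (hconn : 𝓕.GrConnected) {c : k} (hc : c ≠ 0) {y : Fin n → T}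
    (hy : ∀ i, y i ≠ 0) (m : Fin n → ℕ) :
    𝓕.deg (c • (List.ofFn fun i => y i ^ m i).prod) = ∑ i, m i * 𝓕.deg (y i) := by
  have hprod := 𝓕.prod_ne_zero_and_deg_prod (List.ofFn fun i => y i ^ m i) fun a ha => by
    obtain ⟨i, rfl⟩ := List.mem_ofFn.mp ha
    exact (𝓕.pow_ne_zero_and_deg_pow (hy i) (m i)).1
  have hc' : algebraMap k T c ≠ 0 := by
    rw [← map_zero (algebraMap k T)]
    exact fun h => hc (hconn.1 h)
  have hcdeg : 𝓕.deg (algebraMap k T c) = 0 :=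
    Nat.le_zero.mp (𝓕.deg_le (hconn.2 ▸ ⟨c, rfl⟩))
  rw [Algebra.smul_def, (𝓕.mul_ne_zero_and_deg_mul hc' hprod.1).2, hprod.2, hcdeg, zero_add,
    List.map_ofFn, List.sum_ofFn]
  exact Finset.sum_congr rfl fun i _ => (𝓕.pow_ne_zero_and_deg_pow (hy i) (m i)).2

end Degree

end AlgFiltration

/-! ### The polynomial identity -/

/-- A domain of finite rank over its centre satisfies a standard identity. -/
theorem isPIRing_of_finite_centerLoc {A : Type*} [Ring A] [IsDomain A]
    [Module.Finite (CenterFrac A) (CenterLoc A)] : IsPIRing A := by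
  classical
  -- The standard polynomial in `m` variables is alternating over the centre, and any `m` elements
  -- exceed the rank, hence are linearly dependent.
  let m := centerRank A + 1
  let word : Equiv.Perm (Fin m) → FreeMonoid ℕ := fun σ =>
    FreeMonoid.ofList (List.ofFn fun i => (σ i : ℕ))
  have hword : Function.Injective word := fun σ τ h => by
    ext i
    exact congrFun (List.ofFn_injective (FreeMonoid.ofList.injective h)) i
  have hlen : ∀ σ, (word σ).length = m := fun σ => by
    exact List.length_ofFn
  refine ⟨∑ σ : Equiv.Perm (Fin m), MonoidAlgebra.single (word σ) (Equiv.Perm.sign σ : ℤ),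
    ⟨word 1, ?_, ?_⟩, fun y => ?_⟩
  · rw [MonoidAlgebra.coeff_sum, Finsupp.finsetSum_apply,
      Finset.sum_eq_single_of_mem 1 (Finset.mem_univ _)]
    · simp
    · intro σ _ hσ
      rw [MonoidAlgebra.coeff_single, Finsupp.single_eq_of_ne fun h => hσ (hword h.symm)]
  · intro m' hm'
    rw [MonoidAlgebra.coeff_sum, Finsupp.finsetSum_apply] at hm'
    obtain ⟨σ, -, hσ⟩ := Finset.exists_ne_zero_of_sum_ne_zero hm'
    rw [MonoidAlgebra.coeff_single] at hσ
    have : m' = word σ := by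
      by_contra hne
      exact hσ (Finsupp.single_eq_of_ne hne)
    rw [this, hlen, hlen]
  · have hzero := AlternatingMap.map_linearDependent
      (MultilinearMap.alternatization (MultilinearMap.mkPiAlgebraFin (Subring.center A) m A))
      (fun i : Fin m => y i)
      (not_linearIndependent_center_of_centerRank_lt (Nat.lt_succ_self _) _)
    rw [← AlternatingMap.coe_multilinearMap, MultilinearMap.alternatization_coe, sum_apply] at hzero
    rw [map_sum, ← hzero]
    refine Finset.sum_congr rfl fun σ _ => ?_
    rw [MonoidAlgebra.lift_single, FreeMonoid.lift_apply]
    change (Equiv.Perm.sign σ : ℤ) • (List.map y (List.ofFn fun i => (σ i : ℕ))).prod =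
      (Equiv.Perm.sign σ : ℤ) • (List.ofFn fun i => y (σ i)).prod
    rw [List.map_ofFn]
    rfl

/-! ### Filtrations by weighted degree -/

/-- The weighted degree of an exponent vector. -/
def weightedDeg {n : ℕ} (w a : Fin n → ℕ) : ℕ := ∑ i, w i * a i

section WeightedDeg

variable {n : ℕ} (w : Fin n → ℕ)

theorem weightedDeg_add (a b : Fin n → ℕ) :
    weightedDeg w (a + b) = weightedDeg w a + weightedDeg w b := by
  simp [weightedDeg, mul_add, Finset.sum_add_distrib]

theorem weightedDeg_zero : weightedDeg w 0 = 0 := by simp [weightedDeg]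

theorem weightedDeg_single (i : Fin n) : weightedDeg w (Pi.single i 1) = w i := by
  rw [weightedDeg, Finset.sum_eq_single i]
  · simp
  · intro j _ hj; simp [Pi.single_eq_of_ne hj]
  · simp

theorem eq_zero_of_weightedDeg_eq_zero {w : Fin n → ℕ} (hw : ∀ i, 0 < w i) {a : Fin n → ℕ}
    (h : weightedDeg w a = 0) : a = 0 := by
  funext i
  rw [weightedDeg, Finset.sum_eq_zero_iff] at h
  exact (mul_eq_zero.mp (h i (Finset.mem_univ i))).resolve_left (hw i).ne'

end WeightedDeg

namespace MonomialBasis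

variable {k : Type*} [CommRing k] {n : ℕ} {p : Fin n → Fin n → kˣ} {A : Type*} [Ring A]
  [Algebra k A] (B : MonomialBasis p A) (w : Fin n → ℕ)

/-- The elements of weighted degree at most `r`. -/
def weightedLE (r : ℕ) : Submodule k A where
  carrier := {f | ∀ a, B.basis.repr f a ≠ 0 → weightedDeg w a ≤ r}
  zero_mem' a ha := by simp at ha
  add_mem' {f g} hf hg a ha := by
    by_contra! h
    refine ha ?_
    rw [map_add, Finsupp.add_apply, not_imp_comm.mp (hf a) h.not_ge,
      not_imp_comm.mp (hg a) h.not_ge, add_zero]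
  smul_mem' c f hf a ha := hf a fun h0 => ha (by
    rw [map_smul, Finsupp.smul_apply, h0, smul_zero])

theorem mem_weightedLE {r : ℕ} {f : A} :
    f ∈ B.weightedLE w r ↔ ∀ a, B.basis.repr f a ≠ 0 → weightedDeg w a ≤ r := Iff.rfl

theorem mul_mem_weightedLE {i j : ℕ} {f g : A} (hf : f ∈ B.weightedLE w i)
    (hg : g ∈ B.weightedLE w j) : f * g ∈ B.weightedLE w (i + j) := by
  intro e he
  obtain ⟨a, b, ha, hb, rfl⟩ := B.exists_add_eq_of_repr_mul_ne_zero he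
  rw [weightedDeg_add]
  exact add_le_add (hf a ha) (hg b hb)

theorem smul_basis_mem_weightedLE {c : k} (hc : c ≠ 0) (a : Fin n → ℕ) (r : ℕ) :
    c • B.basis a ∈ B.weightedLE w r ↔ weightedDeg w a ≤ r := by
  rw [mem_weightedLE, map_smul, B.basis.repr_self, Finsupp.smul_single_one]
  constructor
  · intro h
    exact h a (by rwa [Finsupp.single_eq_same])
  · intro h b hb
    by_cases hab : b = a
    · rwa [hab]
    · exact absurd (Finsupp.single_eq_of_ne hab) hb

theorem basis_mem_weightedLE [Nontrivial k] (a : Fin n → ℕ) (r : ℕ) :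
    B.basis a ∈ B.weightedLE w r ↔ weightedDeg w a ≤ r := by
  rw [← B.smul_basis_mem_weightedLE w one_ne_zero, one_smul]

theorem one_mem_weightedLE (r : ℕ) : (1 : A) ∈ B.weightedLE w r := by
  intro a ha
  rw [← B.basis_zero, B.basis.repr_self] at ha
  have : a = 0 := by
    by_contra h
    exact ha (Finsupp.single_eq_of_ne h)
  rw [this, weightedDeg_zero]
  exact Nat.zero_le r

/-- The filtration by weighted degree. -/
def weightedFiltration : AlgFiltration k A where
  F := B.weightedLE w
  mono _ _ hij _ hf a ha := (hf a ha).trans hij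
  one_mem := B.one_mem_weightedLE w 0
  mul_mem := B.mul_mem_weightedLE w
  exhaustive f := ⟨(B.basis.repr f).support.sup (weightedDeg w), fun _ ha =>
    Finset.le_sup (f := weightedDeg w) (Finsupp.mem_support_iff.mpr ha)⟩

theorem mem_weightedFiltration_Fpred {r : ℕ} {f : A} :
    f ∈ (B.weightedFiltration w).Fpred r ↔
      ∀ a, B.basis.repr f a ≠ 0 → weightedDeg w a < r := by
  cases r with
  | zero =>
    simp only [Nat.not_lt_zero, imp_false, not_not]
    constructor
    · intro h a
      rw [(show f = 0 from h), map_zero, Finsupp.zero_apply]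
    · intro h
      exact (LinearEquiv.map_eq_zero_iff B.basis.repr).mp (Finsupp.ext h)
  | succ r => simp only [Nat.lt_succ_iff]; rfl

theorem grConnected_weightedFiltration [Nontrivial k] {w : Fin n → ℕ} (hw : ∀ i, 0 < w i) :
    (B.weightedFiltration w).GrConnected := by
  constructor
  · intro c c' h
    rw [Algebra.algebraMap_eq_smul_one, Algebra.algebraMap_eq_smul_one, ← B.basis_zero] at h
    simpa using congrArg (fun x => B.basis.repr x 0) h
  · refine le_antisymm (fun f hf => ?_) ?_
    · refine ⟨B.basis.repr f 0, ?_⟩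
      rw [Algebra.linearMap_apply, Algebra.algebraMap_eq_smul_one, ← B.basis_zero]
      refine B.basis.repr.injective (Finsupp.ext fun a => ?_)
      rw [map_smul, B.basis.repr_self, Finsupp.smul_single_one]
      by_cases ha : a = 0
      · rw [ha, Finsupp.single_eq_same]
      · rw [Finsupp.single_eq_of_ne ha]
        by_contra hne
        exact ha (eq_zero_of_weightedDeg_eq_zero hw (Nat.le_zero.mp (hf a (Ne.symm hne))))
    · rintro _ ⟨c, rfl⟩
      rw [Algebra.linearMap_apply, Algebra.algebraMap_eq_smul_one]
      exact Submodule.smul_mem _ _ (B.one_mem_weightedLE w 0)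

theorem linearIndependent_mkQ_weightedFiltration {w : Fin n → ℕ} (hw : ∀ i, 0 < w i) :
    LinearIndependent k fun i =>
      ((B.weightedFiltration w).F 0).mkQ (B.basis (Pi.single i 1)) := by
  rw [Fintype.linearIndependent_iff]
  intro c hc i
  simp only [← map_smul] at hc
  rw [← map_sum, Submodule.mkQ_apply, Submodule.Quotient.mk_eq_zero] at hc
  have hrepr : B.basis.repr (∑ j, c j • B.basis (Pi.single j 1)) (Pi.single i 1) = c i := by
    rw [map_sum, Finsupp.finsetSum_apply, Finset.sum_eq_single i]
    · simp
    · intro j _ hj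
      rw [map_smul, B.basis.repr_self, Finsupp.smul_single_one, Finsupp.single_eq_of_ne]
      intro h
      have := congrFun h i
      simp [Pi.single_eq_of_ne hj.symm] at this
    · simp
  by_contra hne
  have := hc (Pi.single i 1) (by rwa [hrepr])
  rw [weightedDeg_single] at this
  exact absurd this (hw i).not_ge

/-- The unique sums argument for domains, applied to the exponents of top weight only. -/
theorem isDomain_gr_weightedFiltration [IsDomain k] :
    IsDomain (B.weightedFiltration w).gr := by
  have := B.isDomain
  refine AlgFiltration.isDomain_gr _ fun {i j f g} hf hf' hg hg' hfg => ?_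
  rw [mem_weightedFiltration_Fpred] at hf' hg' hfg
  push Not at hf' hg'
  let S : Finset (Fin n → ℕ) := (B.basis.repr f).support.filter fun a => weightedDeg w a = i
  let S' : Finset (Fin n → ℕ) := (B.basis.repr g).support.filter fun b => weightedDeg w b = j
  have hS : S.Nonempty := by
    obtain ⟨a, ha, hai⟩ := hf'
    exact ⟨a, Finset.mem_filter.mpr ⟨Finsupp.mem_support_iff.mpr ha, le_antisymm (hf a ha) hai⟩⟩
  have hS' : S'.Nonempty := by
    obtain ⟨a, ha, hai⟩ := hg'
    exact ⟨a, Finset.mem_filter.mpr ⟨Finsupp.mem_support_iff.mpr ha, le_antisymm (hg a ha) hai⟩⟩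
  obtain ⟨a, ha, b, hb, hu⟩ := UniqueSums.uniqueAdd_of_nonempty hS hS'
  obtain ⟨ha, hai⟩ := Finset.mem_filter.mp ha
  obtain ⟨hb, hbj⟩ := Finset.mem_filter.mp hb
  rw [Finsupp.mem_support_iff] at ha hb
  -- Uniqueness extends from `S` and `S'` to the full supports: weights are at most i and j, so a
  -- sum of weight i + j needs top weight on both sides.
  have hmul := B.repr_mul_of_unique ha hb fun a' b' ha' hb' hab => by
    have h1 := hf a' ha'
    have h2 := hg b' hb'
    have h3 := congrArg (weightedDeg w) hab
    rw [weightedDeg_add, weightedDeg_add, hai, hbj] at h3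
    exact hu (Finset.mem_filter.mpr ⟨Finsupp.mem_support_iff.mpr ha', by omega⟩)
      (Finset.mem_filter.mpr ⟨Finsupp.mem_support_iff.mpr hb', by omega⟩) hab
  have := hfg (a + b) (by
    rw [hmul]
    exact mul_ne_zero (mul_ne_zero ha hb) (Units.ne_zero _))
  rw [weightedDeg_add, hai, hbj] at this
  exact lt_irrefl _ this

theorem deg_weightedFiltration_smul_basis {c : k} (hc : c ≠ 0) (a : Fin n → ℕ) :
    (B.weightedFiltration w).deg (c • B.basis a) = weightedDeg w a :=
  le_antisymm (Nat.sInf_le ((B.smul_basis_mem_weightedLE w hc a _).mpr le_rfl))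
    ((B.smul_basis_mem_weightedLE w hc a _).mp ((B.weightedFiltration w).mem_F_deg _))

theorem basis_mem_pow (a : Fin n → ℕ) :
    B.basis a ∈ ((1 : Submodule k A) ⊔
      Submodule.span k (Set.range fun i => B.basis (Pi.single i 1))) ^ ∑ i, a i := by
  induction a using exponent_induction with
  | zero => simp [B.basis_zero, Submodule.one_le.mp le_rfl]
  | add_single a i ih =>
    have : ∑ j, (a + Pi.single i 1 : Fin n → ℕ) j = ∑ j, a j + 1 := by
      simp [Finset.sum_add_distrib]
    rw [this, pow_succ, B.basis_add]
    exact Submodule.smul_mem _ _ (Submodule.mul_mem_mul ih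
      (Submodule.mem_sup_right (Submodule.subset_span ⟨i, rfl⟩)))

theorem pow_le_weightedLE [Nontrivial k] (r : ℕ) :
    ((1 : Submodule k A) ⊔ Submodule.span k (Set.range fun i => B.basis (Pi.single i 1))) ^ r ≤
      B.weightedLE 1 r := by
  induction r with
  | zero =>
    rw [pow_zero, Submodule.one_le]
    exact B.one_mem_weightedLE 1 0
  | succ r ih =>
    rw [pow_succ, Submodule.mul_le]
    intro f hf g hg
    refine B.mul_mem_weightedLE 1 (ih hf) ((sup_le ?_ ?_ : _ ≤ B.weightedLE 1 1) hg)
    · rw [Submodule.one_le]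
      exact B.one_mem_weightedLE 1 1
    · rw [Submodule.span_le]
      rintro _ ⟨i, rfl⟩
      exact (B.basis_mem_weightedLE 1 _ _).mpr (by rw [weightedDeg_single, Pi.one_apply])

/-- Writing x^a as a product of letters bounds the degree above; the filtration with all weights 1
bounds it below. -/
theorem stdDeg_smul_basis [Nontrivial k] {c : k} (hc : c ≠ 0) (a : Fin n → ℕ) :
    stdDeg (k := k) (fun i => B.basis (Pi.single i 1)) (c • B.basis a) = ∑ i, a i := by
  have hmem := Submodule.smul_mem _ c (B.basis_mem_pow a)
  refine le_antisymm (Nat.sInf_le hmem) ?_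
  have hmin : c • B.basis a ∈ ((1 : Submodule k A) ⊔
      Submodule.span k (Set.range fun i => B.basis (Pi.single i 1))) ^
        stdDeg (k := k) (fun i => B.basis (Pi.single i 1)) (c • B.basis a) :=
    Nat.sInf_mem (s := {m | c • B.basis a ∈ ((1 : Submodule k A) ⊔
      Submodule.span k (Set.range fun i => B.basis (Pi.single i 1))) ^ m}) ⟨_, hmem⟩
  have := (B.smul_basis_mem_weightedLE 1 hc a _).mp (B.pow_le_weightedLE _ hmin)
  simpa [weightedDeg] using this

end MonomialBasis

/-! ### When a monomial is dominating -/

/-- Test on T = A with y = x, where x_s has weight 2 and the other variables weight 1. Every lift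
evaluates to the monomial itself, whose degree is unchanged because x_s does not occur in it,
although some y_i has degree above 1. -/
theorem MonomialBasis.not_isDominating_smul_basis {k : Type u} [CommRing k] [IsDomain k] {n : ℕ}
    {p : Fin n → Fin n → kˣ} {A : Type u} [Ring A] [Algebra k A] (B : MonomialBasis p A)
    (hfin : ∀ i j, IsOfFinOrder (p i j)) {c : k} (hc : c ≠ 0) {a : Fin n → ℕ} {s : Fin n}
    (has : a s = 0) :
    ¬ IsDominating k (fun i => B.basis (Pi.single i 1)) (c • B.basis a) := by
  have := B.isDomain
  have := B.finite_centerLoc hfin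
  rintro ⟨hne, hdom⟩
  let w : Fin n → ℕ := fun i => if i = s then 2 else 1
  have hw : ∀ i, 0 < w i := fun i => by
    simp only [w]
    split_ifs <;> norm_num
  obtain ⟨φ, hφ, h⟩ := hdom A (B.weightedFiltration w) isPIRing_of_finite_centerLoc
    (B.grConnected_weightedFiltration hw) (B.isDomain_gr_weightedFiltration w) _
    (B.linearIndependent_mkQ_weightedFiltration hw)
  rw [hφ] at h
  have hlt := (h.resolve_left hne).2 ⟨s, by
    rw [← one_smul k (B.basis _), B.deg_weightedFiltration_smul_basis w one_ne_zero,
      weightedDeg_single]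
    simp [w]⟩
  rw [B.stdDeg_smul_basis hc, B.deg_weightedFiltration_smul_basis w hc, weightedDeg] at hlt
  refine hlt.ne (Finset.sum_congr rfl fun i _ => ?_)
  by_cases hi : i = s
  · rw [hi, has, mul_zero]
  · simp [w, hi]

/-- The obvious lift has value of degree ∑ a_i deg y_i. Each deg y_i is at least 1, because y_i lies
outside `F 0`, and a_j > 0 makes the inequality strict wherever deg y_j > 1. -/
theorem isDominating_smul_monomial {k : Type u} [CommRing k] {n : ℕ} {A : Type u}
    [Ring A] [Algebra k A] {x : Fin n → A} {c : k} {a : Fin n → ℕ} [IsDomain k]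
    (hne : c • (List.ofFn fun i => x i ^ a i).prod ≠ 0)
    (hdeg : stdDeg (k := k) x (c • (List.ofFn fun i => x i ^ a i).prod) = ∑ i, a i)
    (ha : ∀ i, 0 < a i) : IsDominating k x (c • (List.ofFn fun i => x i ^ a i).prod) := by
  have hc : c ≠ 0 := fun h => hne (by rw [h, zero_smul])
  refine ⟨hne, fun T _ _ 𝓕 _ hconn _ y hy => ?_⟩
  have hnt : Nontrivial T := hconn.1.nontrivial
  have hy0 : ∀ i, y i ∉ 𝓕.F 0 := fun i h =>
    hy.ne_zero i ((Submodule.Quotient.mk_eq_zero _).mpr h)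
  have hpos : ∀ i, 1 ≤ 𝓕.deg (y i) := fun i => by
    by_contra! h
    refine hy0 i ?_
    rw [← Nat.lt_one_iff.mp h]
    exact 𝓕.mem_F_deg _
  have hlift : ∀ {R : Type u} [Ring R] [Algebra k R] (z : Fin n → R),
      FreeAlgebra.lift k z (c • (List.ofFn fun i => FreeAlgebra.ι k i ^ a i).prod) =
        c • (List.ofFn fun i => z i ^ a i).prod := by
    intro R _ _ z
    rw [map_smul, map_list_prod, List.map_ofFn]
    congr 3
    funext i
    simp
  refine ⟨c • (List.ofFn fun i => FreeAlgebra.ι k i ^ a i).prod, hlift x, Or.inr ?_⟩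
  have hyne : ∀ i, y i ≠ 0 := fun i h => hy0 i (by rw [h]; exact zero_mem _)
  rw [hlift y, 𝓕.deg_smul_monomial hconn hc hyne, hdeg]
  refine ⟨Finset.sum_le_sum fun i _ => Nat.le_mul_of_pos_right _ (hpos i), ?_⟩
  rintro ⟨j, hj⟩
  refine Finset.sum_lt_sum (fun i _ => Nat.le_mul_of_pos_right _ (hpos i))
    ⟨j, Finset.mem_univ j, ?_⟩
  exact (Nat.lt_mul_iff_one_lt_right (ha j)).mpr hj

/-! ### The main theorem -/

theorem theorem2p11 {k : Type u} [CommRing k] [IsDomain k] {n : ℕ}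
    (p : Fin n → Fin n → kˣ) (hdiag : ∀ i, p i i = 1) (hskew : ∀ i j, p j i = (p i j)⁻¹)
    (hroot : ∀ i j, i < j → IsOfFinOrder (p i j)) :
    (∀ v : ℕ, 0 < v →
      (∃ d : SkewPoly p, IsVDiscriminant v d) ∧
      ∀ d : SkewPoly p, IsVDiscriminant v d →
        (v ≤ centerRank (SkewPoly p) → SkewPoly.IsMonomial p d) ∧
        (centerRank (SkewPoly p) < v → d = 0)) ∧
    ((∃ d : SkewPoly p, IsVDiscriminant (centerRank (SkewPoly p)) d) ∧
      ∀ d : SkewPoly p, IsVDiscriminant (centerRank (SkewPoly p)) d →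
        d ≠ 0 ∧
        (∀ s : Fin n, NDvd (SkewPoly.X p s) d ↔ SkewPoly.T p s = ∅) ∧
        (IsDominating k (SkewPoly.X p) d ↔ ∀ s : Fin n, SkewPoly.T p s = ∅)) := by
  have hfin : ∀ i j, IsOfFinOrder (p i j) := by
    intro i j
    rcases lt_trichotomy i j with h | h | h
    · exact hroot i j h
    · rw [h, hdiag]; exact IsOfFinOrder.one
    · rw [hskew j i]; exact (hroot j i h).inv
  let B := SkewPoly.monomialBasis hdiag hskew
  have hB : ∀ a, B.basis a = (List.ofFn fun i => SkewPoly.X p i ^ a i).prod :=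
    SkewPoly.monBasis_apply hdiag hskew
  have hX : (fun i => B.basis (Pi.single i 1)) = SkewPoly.X p :=
    funext (SkewPoly.monomialBasis_single hdiag hskew)
  have hexists : ∀ v, ∃ d : SkewPoly p, IsVDiscriminant v d := by
    intro v
    simp only [B.isVDiscriminant_iff hfin]
    rcases le_or_gt v (centerRank (SkewPoly p)) with hv | hv
    · exact ⟨_, B.isNormalGCD_disc hfin (B.discExponents_nonempty_of_le hfin hv)⟩
    · exact ⟨0, by rw [B.discSet_eq_of_centerRank_lt hfin hv, isNormalGCD_singleton_zero]⟩
  refine ⟨fun v _ => ⟨hexists v, fun d hd => ⟨fun hv => ?_, fun hv => ?_⟩⟩, hexists _,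
    fun d hd => ?_⟩
  · obtain ⟨c, hc, rfl⟩ := B.eq_smul_basis_of_isNormalGCD hfin
      (B.discExponents_nonempty_of_le hfin hv) hd.isGCD
    exact ⟨c, _, hc, by rw [hB]⟩
  · rw [← isNormalGCD_singleton_zero, ← B.discSet_eq_of_centerRank_lt hfin hv]
    exact hd.isGCD
  · obtain ⟨c, hc, rfl⟩ := B.eq_smul_basis_of_isNormalGCD hfin
      (B.discExponents_nonempty_of_le hfin le_rfl) hd.isGCD
    have hne : c • B.basis (minExponent p (centerRank (SkewPoly p))) ≠ 0 := by
      have := B.isDomain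
      have := Module.Free.of_basis B.basis
      exact smul_ne_zero hc (B.basis.ne_zero _)
    have hT : ∀ s, SkewPoly.T p s = ∅ ↔ 0 < minExponent p (centerRank (SkewPoly p)) s := by
      intro s
      rw [Nat.pos_iff_ne_zero, B.centerRank_eq hfin, Ne,
        minExponent_eq_zero_iff hdiag hskew hfin, not_not]
    refine ⟨hne, fun s => ?_, fun hdom s => ?_, fun h => ?_⟩
    -- Read x_s as the monomial with coefficient 1 and exponent e_s: it divides d exactly when e_s
    -- is at most the minimal exponent.
    · rw [hT, ← SkewPoly.monomialBasis_single hdiag hskew, ← one_smul k (MonomialBasis.basis _ _),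
        B.nDvd_smul_basis_iff hc]
      refine ⟨fun h => ?_, fun h => ⟨one_dvd _, fun j => ?_⟩⟩
      · have := h.2 s
        rwa [Pi.single_eq_same] at this
      · by_cases hj : j = s
        · subst hj; rw [Pi.single_eq_same]; exact h
        · simp [Pi.single_eq_of_ne hj]
    · rw [hT]
      by_contra! h
      exact B.not_isDominating_smul_basis hfin hc (Nat.le_zero.mp h) (hX ▸ hdom)
    · have hdeg := B.stdDeg_smul_basis hc (minExponent p (centerRank (SkewPoly p)))
      rw [hX, hB] at hdeg
      rw [hB] at hne ⊢
      exact isDominating_smul_monomial hne hdeg fun i => (hT i).mp (h i)
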